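/- Let $\Omega\subset\mathbb R^3$ be open and let $\Omega_1,\dots,\Omega_M\subset\Omega$ be pairwise disjoint open sets with $\overline\Omega=\bigcup_m\overline{\Omega_m}$. Call $x\in\Omega$ a regular interface point of $\Omega_m,\Omega_n$ with unit normal $\nu$ if there are an open neighbourhood $U$ of $x$ and $f\in C^1(U)$ with $f(x)=0$, $\nabla f(x)=\nu$, $|\nu|=1$, $\Omega_m\cap U=\{f<0\}\cap U$ and $\Omega_n\cap U=\{f>0\}\cap U$. Assume that the points of $\Omega\cap\bigcup_m\partial\Omega_m$ that are not regular interface points form a set of zero surface measure ($\mathcal H^2$). Let $\mu=\sum_m\mu_m1_{\Omega_m}$, $D=\sum_m D_m1_{\Omega_m}$, $\Gamma=\sum_m\Gamma_m1_{\Omega_m}$ with constants $\mu_m,D_m,\Gamma_m>0$. Let $u\in H^1(\Omega)$ be a weak solution of $-\operatorname{div}(D\nabla u)+\mu u=0$ in $\Omega$, i.e. $\int_\Omega D\nabla u\cdot\nabla\varphi+\mu u\varphi\,dx=0$ for all $\varphi\in C_c^\infty(\Omega)$, such that $u$ is essentially bounded above on $\Omega$ and essentially bounded below by a positive constant on every compact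 subset of $\Omega$ (as is the case if $u$ is continuous, strictly positive and bounded on $\overline\Omega$). Assume also that $u$ is $C^1$ on each $\Omega_m$ and that at $\mathcal H^2$-almost every regular interface point of $\Omega_m,\Omega_n$ both $u|_{\Omega_m},\nabla u|_{\Omega_m}$ and $u|_{\Omega_n},\nabla u|_{\Omega_n}$ have limits from inside $\Omega_m$, respectively $\Omega_n$; write $\nabla u_m(x),\nabla u_n(x)$ for the limits of the gradients. Put $H=\Gamma\mu u$. For a function $f$ on $\Omega$, defined up to null sets, and $k\ge0$ let $$J_k(f)=\Omega\setminus\bigcup\{B\subset\Omega : B\text{ open},\ f\in C^k(B)\},$$ where $f\in C^k(B)$ means that $f$ agrees almost everywhere on $B$ with a $C^k$ function. Assume that for $\mathcal H^2$-almost every $x\in J_0(D)\setminus\big(J_0(\Gamma\mu)\cup J_0(\mu/D)\big)$, whenever $x$ is a regular interface point of $\Omega_m,\Omega_n$ with normal $\nu$, one has $|\nabla u_n(x)\cdot\nu|>0$ (since $m$ and $n$ may be exchanged, this concerns both sides). Then $$\overline{J_0(\mu)}\cup\overline{J_0(D)}\cup\overline{J_0(\Gamma)}=\overline{J_2(H)}.$$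 -/

import Mathlib

open MeasureTheory Filter Topology
open scoped ContDiff Gradient

namespace Photoacoustic

/-- Euclidean three-space. -/
abbrev E3 : Type := EuclideanSpace ℝ (Fin 3)

/-- `f ∈ C^k(B)` for an essentially bounded function `f` (defined up to null sets) and an open
set `B`: `f` agrees almost everywhere on `B` with a function that is `C^k` on `B`. -/
def IsCk (k : ℕ) (f : E3 → ℝ) (B : Set E3) : Prop :=
  ∃ g : E3 → ℝ, ContDiffOn ℝ k g B ∧ f =ᵐ[volume.restrict B] g

/-- `J_k(f) = Ω \ ⋃ {B ⊆ Ω : B open, f ∈ C^k(B)}`, the set of discontinuities of `f` and of its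
derivatives up to order `k`. -/
def jumpSet (k : ℕ) (Ω : Set E3) (f : E3 → ℝ) : Set E3 :=
  Ω \ ⋃₀ {B : Set E3 | B ⊆ Ω ∧ IsOpen B ∧ IsCk k f B}

/-- The piecewise constant function `∑ m, c_m 1_{Ω_m}`. -/
noncomputable def piecewiseConst {M : ℕ} (P : Fin M → Set E3) (c : Fin M → ℝ) (x : E3) : ℝ :=
  ∑ m, (P m).indicator (fun _ => c m) x

/-- Near `x` the common boundary of `Ω_m` and `Ω_n` is a `C^1` hypersurface separating the two sets
(which fill a neighbourhood of `x` up to that hypersurface), and `ν` is its unit normal at `x`,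
pointing from `Ω_m` to `Ω_n`. -/
def IsInterfaceNormal {M : ℕ} (P : Fin M → Set E3) (m n : Fin M) (x ν : E3) : Prop :=
  ‖ν‖ = 1 ∧ ∃ (U : Set E3) (f : E3 → ℝ), IsOpen U ∧ x ∈ U ∧ ContDiffOn ℝ 1 f U ∧
    f x = 0 ∧ HasGradientAt f ν x ∧
    P m ∩ U = {y | f y < 0} ∩ U ∧ P n ∩ U = {y | 0 < f y} ∩ U

/-- The points of `Ω` on the subregion boundaries which are not on a `C^1` interface between two
subregions (junctions of more subregions, edges, corners). -/
def singularPoints {M : ℕ} (Ω : Set E3) (P : Fin M → Set E3) : Set E3 :=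
  {x ∈ Ω ∩ ⋃ m, frontier (P m) | ¬ ∃ m n ν, IsInterfaceNormal P m n x ν}

/-- `(Ω_m)` is a partition of the open set `Ω` into open subregions with (up to a set of zero
surface measure) `C^1` interfaces. -/
structure IsPartition {M : ℕ} (Ω : Set E3) (P : Fin M → Set E3) : Prop where
  isOpen : IsOpen Ω
  isOpen_part : ∀ m, IsOpen (P m)
  subset : ∀ m, P m ⊆ Ω
  disjoint : ∀ m n, m ≠ n → Disjoint (P m) (P n)
  closure_eq : closure Ω = ⋃ m, closure (P m)
  null_singular : Measure.hausdorffMeasure 2 (singularPoints Ω P) = 0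

/-- `φ ∈ C_c^∞(Ω)`. -/
def IsTestFunction (Ω : Set E3) (φ : E3 → ℝ) : Prop :=
  ContDiff ℝ ∞ φ ∧ HasCompactSupport φ ∧ tsupport φ ⊆ Ω

/-- `g` is the weak gradient of `u` in `Ω`. -/
def IsWeakGradient (Ω : Set E3) (u : E3 → ℝ) (g : E3 → E3) : Prop :=
  ∀ φ : E3 → ℝ, IsTestFunction Ω φ → ∀ v : E3,
    ∫ x in Ω, u x * inner ℝ (∇ φ x) v = - ∫ x in Ω, inner ℝ (g x) v * φ x

/-- `u ∈ H^1(Ω)` is a weak solution of `-div (D ∇u) + μ u = 0` in `Ω`. -/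
def IsWeakSolution (Ω : Set E3) (μ D u : E3 → ℝ) : Prop :=
  MemLp u 2 (volume.restrict Ω) ∧
  ∃ g : E3 → E3, MemLp g 2 (volume.restrict Ω) ∧ IsWeakGradient Ω u g ∧
    ∀ φ : E3 → ℝ, IsTestFunction Ω φ →
      ∫ x in Ω, (D x * inner ℝ (g x) (∇ φ x) + μ x * u x * φ x) = 0

/-- The gradient of `u|_A` extended continuously to `x`, i.e. its limit at `x` from inside `A`. -/
noncomputable def innerGradient (A : Set E3) (u : E3 → ℝ) (x : E3) : E3 :=
  extendFrom A (∇ u) x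

/-- `u` is a fluence for absorption `μ` and diffusion `D` in `Ω`: a weak solution of the diffusion
equation, bounded and strictly positive, such that each `u|_{Ω_m}` is `C^1` and extends, together
with its gradient, continuously to almost every interface point (for the surface measure).
No continuity of `u` across the interfaces is asked for, so strict positivity is meant as
an essential positive lower bound on each compact subset of `Ω`. -/
structure IsFluence {M : ℕ} (Ω : Set E3) (P : Fin M → Set E3) (μ D u : E3 → ℝ) : Prop where
  weak : IsWeakSolution Ω μ D u
  bounded : ∃ C : ℝ, ∀ᵐ x ∂(volume.restrict Ω), u x ≤ C
  pos : ∀ K : Set E3, IsCompact K → K ⊆ Ω →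
    ∃ c : ℝ, 0 < c ∧ ∀ᵐ x ∂(volume.restrict K), c ≤ u x
  contDiffOn : ∀ m, ContDiffOn ℝ 1 u (P m)
  extends_ae : ∀ᵐ x ∂((Measure.hausdorffMeasure 2 : Measure E3).restrict Ω),
    ∀ m n ν, IsInterfaceNormal P m n x ν → ∀ k, k = m ∨ k = n →
      (∃ a : ℝ, Tendsto u (𝓝[P k] x) (𝓝 a)) ∧ (∃ b : E3, Tendsto (∇ u) (𝓝[P k] x) (𝓝 b))

/-- Almost everywhere on the part of the jump set of `D` that belongs neither to the jump set of
`Γ μ` nor to that of `μ / D`, the one-sided normal derivatives of `u` do not vanish. (The pairs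
`(m, n)` are ordered and `ν` may be reversed, so both sides are covered.) -/
def NormalDerivNonvanishing {M : ℕ} (Ω : Set E3) (P : Fin M → Set E3) (μ D Γ u : E3 → ℝ) : Prop :=
  ∀ᵐ x ∂((Measure.hausdorffMeasure 2 : Measure E3).restrict
      (jumpSet 0 Ω D \
        (jumpSet 0 Ω (fun y => Γ y * μ y) ∪ jumpSet 0 Ω (fun y => μ y / D y)))),
    ∀ m n ν, IsInterfaceNormal P m n x ν →
      0 < |inner ℝ (innerGradient (P n) u x) ν|

end Photoacoustic

namespace Photoacoustic

/-! The two sets agree even before closures are taken, so both inclusions are local questions at a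
point `x` of `Ω`.

Suppose `H` agrees near `x` with a `C²` function `g`. Rescaling test functions around a regular
interface point shows that the weak formulation forces the two limits of `u`, and those of the flux
`D ∂_ν u`, to coincide there (`IsFluence.interface_conditions`). Since `u > 0`, continuity of `g`
makes `Γμ` equal on both sides, continuity of `∇g` then makes the limits of `∇u` equal, and `Δg =
(μ/D) g` on each side makes `μ/D` equal (`IsFluence.values_of_contDiffOn`). If `D` still jumped,
flux continuity would give `∂_ν u = 0` at a point of `J_0(D)` outside `J_0(Γμ)` and `J_0(μ/D)`,
which is excluded. So `μ`, `D`, `Γ` do not jump at almost every interface point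
(`IsFluence.coeff_eq_of_contDiffOn`). They are therefore locally constant off a set of zero `H²`
measure. Such a set cannot separate a ball, because almost every line in a given direction misses
it, so the coefficients are constant near `x` (`exists_ae_eq_const`).

Conversely, coefficients that are continuous near `x` take finitely many values, hence are constant
on a ball. There `u` solves `Δu = (μ/D) u` in the distributional sense, and Weyl's lemma
(`exists_contDiff_of_integral_lap`) gives a `C²` representative. Weyl's lemma is proved by testing
with a truncated Yukawa potential regularised at scale `δ`. Applying `Δ - k²` to it gives a fixed
smooth kernel plus a part that concentrates, as `δ → 0`, to a multiple of the Dirac mass. At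
Lebesgue points `u` is thus a convolution with a smooth kernel. -/

/-! ### Test functions, weak derivatives and the Laplacian -/

/-- The standard basis vectors of Euclidean three-space. -/
noncomputable abbrev stdVec (i : Fin 3) : E3 := EuclideanSpace.single i (1 : ℝ)

/-- The Laplacian as the sum of the second partial derivatives. -/
noncomputable def lap (φ : E3 → ℝ) (x : E3) : ℝ :=
  ∑ i, fderiv ℝ (fun y => fderiv ℝ φ y (stdVec i)) x (stdVec i)

theorem inner_gradient_left (φ : E3 → ℝ) (x v : E3) : inner ℝ (∇ φ x) v = fderiv ℝ φ x v := by
  simp [gradient]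

theorem inner_eq_sum_stdVec (a b : E3) :
    inner ℝ a b = ∑ i, inner ℝ a (stdVec i) * inner ℝ b (stdVec i) := by
  simp [PiLp.inner_apply, mul_comm]

theorem eq_of_inner_stdVec {a b : E3} (h : ∀ i, inner ℝ a (stdVec i) = inner ℝ b (stdVec i)) :
    a = b := by
  ext i
  have := h i
  simpa [stdVec, EuclideanSpace.inner_single_right] using this

theorem IsTestFunction.mono {V W : Set E3} {φ : E3 → ℝ} (h : IsTestFunction V φ) (hVW : V ⊆ W) :
    IsTestFunction W φ :=
  ⟨h.1, h.2.1, h.2.2.trans hVW⟩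

theorem IsTestFunction.continuous {V : Set E3} {φ : E3 → ℝ} (h : IsTestFunction V φ) :
    Continuous φ := h.1.continuous

theorem IsTestFunction.fderiv_apply {V : Set E3} {φ : E3 → ℝ} (h : IsTestFunction V φ) (v : E3) :
    IsTestFunction V (fun y => fderiv ℝ φ y v) := by
  refine ⟨(h.1.fderiv_right (m := ∞) (by simp)).clm_apply contDiff_const,
    h.2.1.fderiv_apply (𝕜 := ℝ) v, ?_⟩
  exact (tsupport_fderiv_apply_subset ℝ v).trans h.2.2

theorem IsTestFunction.eq_zero {V : Set E3} {φ : E3 → ℝ} (h : IsTestFunction V φ) {x : E3}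
    (hx : x ∉ V) : φ x = 0 :=
  image_eq_zero_of_notMem_tsupport fun hx' => hx (h.2.2 hx')

theorem IsTestFunction.gradient_eq_zero {V : Set E3} {φ : E3 → ℝ} (h : IsTestFunction V φ) {x : E3}
    (hx : x ∉ V) : ∇ φ x = 0 :=
  eq_of_inner_stdVec fun i => by
    rw [inner_gradient_left, (h.fderiv_apply (stdVec i)).eq_zero hx, inner_zero_left]

theorem IsTestFunction.lap_eq_zero {V : Set E3} {φ : E3 → ℝ} (h : IsTestFunction V φ) {x : E3}
    (hx : x ∉ V) : lap φ x = 0 :=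
  Finset.sum_eq_zero fun i _ => ((h.fderiv_apply (stdVec i)).fderiv_apply (stdVec i)).eq_zero hx

theorem IsTestFunction.integrable_mul {V : Set E3} {φ h : E3 → ℝ} (hφ : IsTestFunction V φ)
    (hV : IsOpen V) (hh : ContinuousOn h V) : Integrable (fun x => h x * φ x) := by
  have hs : tsupport (fun x => h x * φ x) ⊆ tsupport φ := tsupport_mul_subset_right
  refine Continuous.integrable_of_hasCompactSupport ?_ hφ.2.1.mul_left
  refine continuous_of_tsupport fun x hx => ?_
  exact (hh.continuousAt (hV.mem_nhds (hφ.2.2 (hs hx)))).mul hφ.continuous.continuousAt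

theorem IsTestFunction.integral_mul_fderiv {V : Set E3} {φ u : E3 → ℝ} (hφ : IsTestFunction V φ)
    (hV : IsOpen V) (hu : ContDiffOn ℝ 1 u V) (v : E3) :
    ∫ x, u x * fderiv ℝ φ x v = -∫ x, fderiv ℝ u x v * φ x := by
  refine integral_mul_fderiv_eq_neg_fderiv_mul_of_integrable ?_ ?_ ?_ ?_ ?_
  · exact hφ.integrable_mul hV
      ((hu.continuousOn_fderiv_of_isOpen hV le_rfl).clm_apply continuousOn_const)
  · exact (hφ.fderiv_apply v).integrable_mul hV hu.continuousOn
  · exact hφ.integrable_mul hV hu.continuousOn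
  · exact fun x hx => (hu.differentiableOn one_ne_zero).differentiableAt (hV.mem_nhds (hφ.2.2 hx))
  · exact fun x _ => (hφ.1.differentiable (by simp)).differentiableAt

theorem IsTestFunction.setIntegral_eq {V Ω : Set E3} {φ : E3 → ℝ} (hφ : IsTestFunction V φ)
    (hV : V ⊆ Ω) (h : E3 → ℝ) : ∫ x in Ω, h x * φ x = ∫ x, h x * φ x :=
  setIntegral_eq_integral_of_forall_compl_eq_zero fun x hx => by
    rw [hφ.eq_zero fun h' => hx (hV h'), mul_zero]

theorem _root_.MeasureTheory.MemLp.integrable_mul_test {Ω : Set E3} {φ h : E3 → ℝ}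
    (hh : MemLp h 2 (volume.restrict Ω)) (hφ : IsTestFunction Ω φ) :
    Integrable (fun x => h x * φ x) (volume.restrict Ω) := by
  have : MemLp φ 2 (volume.restrict Ω) :=
    (hφ.continuous.memLp_of_hasCompactSupport hφ.2.1).restrict Ω
  exact hh.integrable_mul this

theorem _root_.MeasureTheory.MemLp.locallyIntegrableOn_open {F : Type*} [NormedAddCommGroup F]
    {Ω : Set E3} {h : E3 → F} (hΩ : IsOpen Ω) (hh : MemLp h 2 (volume.restrict Ω)) :
    LocallyIntegrableOn h Ω := by
  rw [locallyIntegrableOn_iff hΩ.isLocallyClosed]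
  intro K hK hKc
  have : MemLp h 2 (volume.restrict K) := hh.mono_measure (Measure.restrict_mono hK le_rfl)
  have : IsFiniteMeasure (volume.restrict K : Measure E3) := ⟨by simpa using hKc.measure_lt_top⟩
  exact MemLp.integrable (q := 2) (by norm_num) ‹_›

/-- On test functions supported in `V`, integration by parts gives the classical gradient the same
pairings as `g`; the fundamental lemma of the calculus of variations does the rest, one component at
a time. -/
theorem IsWeakGradient.ae_eq_gradient {Ω V : Set E3} {u : E3 → ℝ} {g : E3 → E3}
    (hg : IsWeakGradient Ω u g) (hgL : MemLp g 2 (volume.restrict Ω)) (hΩ : IsOpen Ω)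
    (hV : IsOpen V) (hVΩ : V ⊆ Ω) (hu : ContDiffOn ℝ 1 u V) :
    ∀ᵐ x, x ∈ V → g x = ∇ u x := by
  have key : ∀ i, ∀ᵐ x, x ∈ V → inner ℝ (g x) (stdVec i) - fderiv ℝ u x (stdVec i) = 0 := by
    intro i
    have hc : ContinuousOn (fun x => fderiv ℝ u x (stdVec i)) V :=
      (hu.continuousOn_fderiv_of_isOpen hV le_rfl).clm_apply continuousOn_const
    have hl : MemLp (fun x => inner ℝ (g x) (stdVec i)) 2 (volume.restrict Ω) :=
      hgL.inner_const (𝕜 := ℝ) (stdVec i)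
    refine hV.ae_eq_zero_of_integral_contDiff_smul_eq_zero ?_ ?_
    · exact ((hl.locallyIntegrableOn_open hΩ).mono_set hVΩ).sub
        (hc.locallyIntegrableOn hV.measurableSet)
    · intro φ h1 h2 h3
      have hφ : IsTestFunction V φ := ⟨h1, h2, h3⟩
      have e1 := hg φ (hφ.mono hVΩ) (stdVec i)
      simp only [inner_gradient_left] at e1
      rw [(hφ.fderiv_apply _).setIntegral_eq hVΩ, hφ.integral_mul_fderiv hV hu,
        hφ.setIntegral_eq hVΩ fun x => inner ℝ (g x) (stdVec i), neg_inj] at e1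
      have i1 : Integrable (fun x => inner ℝ (g x) (stdVec i) * φ x) := by
        have := hl.integrable_mul_test (hφ.mono hVΩ)
        rwa [← IntegrableOn, integrableOn_iff_integrable_of_support_subset] at this
        intro x hx
        by_contra h'
        exact hx (by simp [hφ.eq_zero fun h => h' (hVΩ h)])
      have i2 := hφ.integrable_mul hV hc
      simp only [smul_eq_mul, mul_sub]
      simp_rw [mul_comm (φ _)]
      rw [integral_sub i1 i2, e1, sub_self]
  filter_upwards [ae_all_iff.2 key] with x hx hxV
  refine eq_of_inner_stdVec fun i => ?_
  rw [inner_gradient_left, sub_eq_zero.1 (hx i hxV)]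

/-- Testing the weak gradient with `∂ᵢφ` moves the second derivative onto `φ`, so no regularity of
`u` on `V` is needed. This is the form in which Weyl's lemma uses the equation. -/
theorem IsWeakSolution.integral_lap {Ω V : Set E3} {μ D u : E3 → ℝ} {μ₀ D₀ : ℝ}
    (h : IsWeakSolution Ω μ D u) (hVΩ : V ⊆ Ω)
    (hμ : ∀ᵐ x, x ∈ V → μ x = μ₀) (hD : ∀ᵐ x, x ∈ V → D x = D₀) {φ : E3 → ℝ}
    (hφ : IsTestFunction V φ) : D₀ * ∫ x, u x * lap φ x = μ₀ * ∫ x, u x * φ x := by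
  obtain ⟨huL, g, hgL, hg, hw⟩ := h
  have hφΩ := hφ.mono hVΩ
  have hl : ∀ i, MemLp (fun x => inner ℝ (g x) (stdVec i)) 2 (volume.restrict Ω) :=
    fun i => hgL.inner_const (𝕜 := ℝ) (stdVec i)
  have e1 : ∫ x in Ω, u x * lap φ x
      = - ∑ i, ∫ x in Ω, inner ℝ (g x) (stdVec i) * fderiv ℝ φ x (stdVec i) := by
    simp only [lap, Finset.mul_sum]
    rw [integral_finsetSum _ fun i _ => huL.integrable_mul_test
      ((hφΩ.fderiv_apply (stdVec i)).fderiv_apply (stdVec i)), ← Finset.sum_neg_distrib]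
    refine Finset.sum_congr rfl fun i _ => ?_
    have := hg _ (hφΩ.fderiv_apply (stdVec i)) (stdVec i)
    simpa only [inner_gradient_left] using this
  have e2 : ∫ x in Ω, (D x * inner ℝ (g x) (∇ φ x) + μ x * u x * φ x)
      = ∫ x in Ω, (D₀ * (∑ i, inner ℝ (g x) (stdVec i) * fderiv ℝ φ x (stdVec i))
        + μ₀ * (u x * φ x)) := by
    refine integral_congr_ae (ae_restrict_of_ae ?_)
    filter_upwards [hμ, hD] with x h1 h2
    by_cases hx : x ∈ V
    · rw [h1 hx, h2 hx, inner_eq_sum_stdVec]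
      simp only [inner_gradient_left, mul_assoc]
    · have : ∀ i, fderiv ℝ φ x (stdVec i) = 0 := fun i => (hφ.fderiv_apply _).eq_zero hx
      simp [hφ.eq_zero hx, hφ.gradient_eq_zero hx, this]
  have hi : ∀ i, Integrable (fun x => inner ℝ (g x) (stdVec i) * fderiv ℝ φ x (stdVec i))
      (volume.restrict Ω) := fun i => (hl i).integrable_mul_test (hφΩ.fderiv_apply _)
  rw [hw φ hφΩ, integral_add ((integrable_finsetSum _ fun i _ => hi i).const_mul _)
    ((huL.integrable_mul_test hφΩ).const_mul _), integral_const_mul, integral_const_mul,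
    integral_finsetSum _ fun i _ => hi i] at e2
  have e3 : ∫ x in Ω, u x * lap φ x = ∫ x, u x * lap φ x := by
    refine setIntegral_eq_integral_of_forall_compl_eq_zero fun x hx => ?_
    rw [hφΩ.lap_eq_zero hx, mul_zero]
  rw [← e3, ← hφΩ.setIntegral_eq subset_rfl u, e1]
  linarith

theorem continuousOn_lap {B : Set E3} {g : E3 → ℝ} (hB : IsOpen B) (hg : ContDiffOn ℝ 2 g B) :
    ContinuousOn (lap g) B := by
  unfold lap
  refine continuousOn_finsetSum _ fun i _ => ?_
  have hd : ContDiffOn ℝ 1 (fun y => fderiv ℝ g y (stdVec i)) B :=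
    (hg.fderiv_of_isOpen hB (m := 1) (by norm_num)).clm_apply contDiffOn_const
  exact (hd.continuousOn_fderiv_of_isOpen hB le_rfl).clm_apply continuousOn_const

/-- Two integrations by parts and the fundamental lemma give the equation almost everywhere;
continuity of both sides removes the exceptional set. -/
theorem lap_eq_of_integral_lap {V : Set E3} {w : E3 → ℝ} {κ : ℝ} (hV : IsOpen V)
    (hw : ContDiffOn ℝ 2 w V)
    (h : ∀ φ, IsTestFunction V φ → ∫ x, w x * lap φ x = κ * ∫ x, w x * φ x) :
    ∀ x ∈ V, lap w x = κ * w x := by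
  have hd : ∀ i, ContDiffOn ℝ 1 (fun y => fderiv ℝ w y (stdVec i)) V := fun i =>
    (hw.fderiv_of_isOpen hV (m := 1) (by norm_num)).clm_apply contDiffOn_const
  have hdd : ∀ i, ContinuousOn
      (fun x => fderiv ℝ (fun y => fderiv ℝ w y (stdVec i)) x (stdVec i)) V := fun i =>
    ((hd i).continuousOn_fderiv_of_isOpen hV le_rfl).clm_apply continuousOn_const
  have hlc : ContinuousOn (lap w) V := continuousOn_lap hV hw
  have hc : ContinuousOn (fun x => lap w x - κ * w x) V :=
    hlc.sub (continuousOn_const.mul hw.continuousOn)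
  have hae : ∀ᵐ x, x ∈ V → lap w x - κ * w x = 0 := by
    refine hV.ae_eq_zero_of_integral_contDiff_smul_eq_zero
      (hc.locallyIntegrableOn hV.measurableSet) fun φ h1 h2 h3 => ?_
    have hφ : IsTestFunction V φ := ⟨h1, h2, h3⟩
    have e := h φ hφ
    have e1 : ∫ x, w x * lap φ x = ∫ x, lap w x * φ x := by
      simp only [lap, Finset.mul_sum, Finset.sum_mul]
      rw [integral_finsetSum _ fun i _ => ((hφ.fderiv_apply (stdVec i)).fderiv_apply
        (stdVec i)).integrable_mul hV hw.continuousOn,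
        integral_finsetSum _ fun i _ => hφ.integrable_mul hV (hdd i)]
      refine Finset.sum_congr rfl fun i _ => ?_
      rw [(hφ.fderiv_apply _).integral_mul_fderiv hV (hw.of_le (by norm_num)),
        hφ.integral_mul_fderiv hV (hd i), neg_neg]
    simp only [smul_eq_mul, mul_comm (φ _), sub_mul, mul_assoc]
    rw [integral_sub (hφ.integrable_mul hV hlc)
      ((hφ.integrable_mul hV hw.continuousOn).const_mul κ), integral_const_mul, ← e, e1, sub_self]
  have heq : Set.EqOn (fun x => lap w x - κ * w x) (fun _ => 0) V :=
    Measure.eqOn_open_of_ae_eq (μ := volume) ((ae_restrict_iff' hV.measurableSet).2 hae) hV hc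
      continuousOn_const
  exact fun x hx => sub_eq_zero.1 (heq hx)

/-! ### Weyl's lemma for `Δ - k²` via a regularised Yukawa potential -/

/-- The operator induced by `Δ - k²` on functions of `s = ‖x‖²`. -/
noncomputable def radialOp (k : ℝ) (F : ℝ → ℝ) (s : ℝ) : ℝ :=
  4 * s * deriv (deriv F) s + 6 * deriv F s - k ^ 2 * F s

theorem radialOp_congr {k s : ℝ} {F G : ℝ → ℝ} (h : F =ᶠ[𝓝 s] G) :
    radialOp k F s = radialOp k G s := by
  rw [radialOp, radialOp, h.deriv.deriv_eq, h.deriv_eq, h.eq_of_nhds]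

theorem contDiff_radialOp {k : ℝ} {F : ℝ → ℝ} (hF : ContDiff ℝ ∞ F) :
    ContDiff ℝ ∞ (radialOp k F) := by
  have h1 : ContDiff ℝ ∞ (deriv F) := (contDiff_infty_iff_deriv.1 hF).2
  have h2 : ContDiff ℝ ∞ (deriv (deriv F)) := (contDiff_infty_iff_deriv.1 h1).2
  unfold radialOp
  fun_prop

theorem lap_radial {F : ℝ → ℝ} (hF : ContDiff ℝ ∞ F) (a x : E3) :
    lap (fun y => F (‖y - a‖ ^ 2)) x
      = 4 * ‖x - a‖ ^ 2 * deriv (deriv F) (‖x - a‖ ^ 2) + 6 * deriv F (‖x - a‖ ^ 2) := by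
  have hF1 : ContDiff ℝ ∞ (deriv F) := (contDiff_infty_iff_deriv.1 hF).2
  have hn : ∀ y : E3, HasFDerivAt (fun y => ‖y - a‖ ^ 2) (2 • innerSL ℝ (y - a)) y := fun y => by
    simpa using ((hasFDerivAt_id y).sub_const a).norm_sq
  have h1 : ∀ (i : Fin 3) (y : E3), fderiv ℝ (fun y => F (‖y - a‖ ^ 2)) y (stdVec i)
      = deriv F (‖y - a‖ ^ 2) * (2 * (y i - a i)) := fun i y => by
    have := ((hF.differentiable (by simp)).differentiableAt
      (x := ‖y - a‖ ^ 2)).hasDerivAt.comp_hasFDerivAt y (hn y)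
    have h' := this.fderiv
    simp only [Function.comp_def] at h'
    rw [h']
    simp [stdVec, EuclideanSpace.inner_single_right]
  have h2 : ∀ (i : Fin 3), fderiv ℝ (fun y => fderiv ℝ (fun y => F (‖y - a‖ ^ 2)) y (stdVec i)) x
      (stdVec i) = deriv (deriv F) (‖x - a‖ ^ 2) * (2 * (x i - a i)) ^ 2
        + 2 * deriv F (‖x - a‖ ^ 2) := fun i => by
    simp_rw [h1]
    have e1 := ((hF1.differentiable (by simp)).differentiableAt
      (x := ‖x - a‖ ^ 2)).hasDerivAt.comp_hasFDerivAt x (hn x)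
    have e2 : HasFDerivAt (fun y : E3 => 2 * (y i - a i))
        ((2 : ℝ) • (EuclideanSpace.proj i : E3 →L[ℝ] ℝ)) x :=
      (((EuclideanSpace.proj i : E3 →L[ℝ] ℝ).hasFDerivAt).sub_const (a i)).const_mul 2
    have h' := (e1.mul e2).fderiv
    simp only [Function.comp_def] at h'
    erw [h']
    simp [stdVec, EuclideanSpace.inner_single_right]
    ring
  have h3 : ‖x - a‖ ^ 2 = ∑ i, (x i - a i) ^ 2 := by
    simp [EuclideanSpace.norm_sq_eq]
  rw [lap]
  simp_rw [h2]
  rw [Finset.sum_add_distrib, ← Finset.mul_sum]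
  simp_rw [mul_pow]
  rw [← Finset.mul_sum, ← h3]
  simp
  ring

/-- The Yukawa potential `e^{-kr} / r` as a function of `s = r²`. -/
noncomputable def yukawa (k s : ℝ) : ℝ := Real.exp (-k * √s) / √s

/-- The derivative of `yukawa k`. -/
noncomputable def yukawaDeriv (k s : ℝ) : ℝ :=
  -(k / √s ^ 2 + 1 / √s ^ 3) * Real.exp (-k * √s) / 2

theorem contDiffAt_yukawa (k : ℝ) {s : ℝ} (hs : 0 < s) : ContDiffAt ℝ ∞ (yukawa k) s := by
  have h : ContDiffAt ℝ ∞ (fun s => √s) s := contDiffAt_id.sqrt hs.ne'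
  exact (contDiffAt_const.mul h).exp.div h (Real.sqrt_pos.2 hs).ne'

theorem hasDerivAt_yukawa (k : ℝ) {s : ℝ} (hs : 0 < s) :
    HasDerivAt (yukawa k) (yukawaDeriv k s) s := by
  have h := Real.hasDerivAt_sqrt hs.ne'
  have hr : √s ≠ 0 := (Real.sqrt_pos.2 hs).ne'
  refine ((h.const_mul (-k)).exp.div h hr).congr_deriv ?_
  rw [yukawaDeriv]
  field_simp
  ring

theorem hasDerivAt_yukawaDeriv (k : ℝ) {s : ℝ} (hs : 0 < s) :
    HasDerivAt (yukawaDeriv k)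
      ((k ^ 2 / √s ^ 3 + 3 * k / √s ^ 4 + 3 / √s ^ 5) * Real.exp (-k * √s) / 4) s := by
  have h := Real.hasDerivAt_sqrt hs.ne'
  have hr : √s ≠ 0 := (Real.sqrt_pos.2 hs).ne'
  refine ((((((hasDerivAt_const s k).div (h.pow 2) (pow_ne_zero 2 hr)).add
    ((hasDerivAt_const s 1).div (h.pow 3) (pow_ne_zero 3 hr))).neg).mul
    (h.const_mul (-k)).exp).div_const 2).congr_deriv ?_
  simp only [Pi.add_apply, Pi.neg_apply, Pi.div_apply, Pi.pow_apply]
  field_simp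
  ring

theorem deriv_yukawa (k : ℝ) {s : ℝ} (hs : 0 < s) : deriv (yukawa k) s = yukawaDeriv k s :=
  (hasDerivAt_yukawa k hs).deriv

theorem deriv_yukawa_eventuallyEq (k : ℝ) {s : ℝ} (hs : 0 < s) :
    deriv (yukawa k) =ᶠ[𝓝 s] yukawaDeriv k := by
  filter_upwards [eventually_gt_nhds hs] with t ht using deriv_yukawa k ht

theorem radialOp_yukawa (k : ℝ) {s : ℝ} (hs : 0 < s) : radialOp k (yukawa k) s = 0 := by
  have hr : √s ≠ 0 := (Real.sqrt_pos.2 hs).ne'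
  rw [radialOp, (deriv_yukawa_eventuallyEq k hs).deriv_eq, deriv_yukawa k hs,
    (hasDerivAt_yukawaDeriv k hs).deriv, yukawa, yukawaDeriv]
  have : s = √s ^ 2 := (Real.sq_sqrt hs.le).symm
  generalize √s = r at *
  subst this
  field_simp
  ring

/-- By the product rule, the terms in which `T` is not differentiated add up to `T` times `radialOp
k (yukawa k)`, which vanishes. Only derivatives of the cutoff survive. -/
theorem radialOp_mul_yukawa (k : ℝ) {s : ℝ} (hs : 0 < s) {T : ℝ → ℝ} (hT : ContDiff ℝ ∞ T) :
    radialOp k (fun t => T t * yukawa k t) s = 4 * s * deriv (deriv T) s * yukawa k s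
      + 8 * s * deriv T s * yukawaDeriv k s + 6 * deriv T s * yukawa k s := by
  have hT1 : ContDiff ℝ ∞ (deriv T) := (contDiff_infty_iff_deriv.1 hT).2
  have d0 : ∀ t, HasDerivAt T (deriv T t) t := fun t =>
    (hT.differentiable (by simp)).differentiableAt.hasDerivAt
  have d1 : HasDerivAt (deriv T) (deriv (deriv T) s) s :=
    (hT1.differentiable (by simp)).differentiableAt.hasDerivAt
  have e : deriv (fun t => T t * yukawa k t)
      =ᶠ[𝓝 s] fun t => deriv T t * yukawa k t + T t * yukawaDeriv k t := by
    filter_upwards [eventually_gt_nhds hs] with t ht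
    exact ((d0 t).mul (hasDerivAt_yukawa k ht)).deriv
  have hy := radialOp_yukawa k hs
  rw [radialOp, (deriv_yukawa_eventuallyEq k hs).deriv_eq, deriv_yukawa k hs,
    (hasDerivAt_yukawaDeriv k hs).deriv] at hy
  have e2 : HasDerivAt (fun t => deriv T t * yukawa k t + T t * yukawaDeriv k t) _ s :=
    (d1.mul (hasDerivAt_yukawa k hs)).add ((d0 s).mul (hasDerivAt_yukawaDeriv k hs))
  rw [radialOp, e.deriv_eq, e.eq_of_nhds, e2.deriv]
  linear_combination T s * hy

/-- A smooth step: `0` below `1/4`, `1` above `1/2`. -/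
noncomputable def step (t : ℝ) : ℝ := Real.smoothTransition (4 * t - 1)

theorem contDiff_step : ContDiff ℝ ∞ step :=
  Real.smoothTransition.contDiff.comp ((contDiff_const.mul contDiff_id).sub contDiff_const)

theorem step_eq_zero {t : ℝ} (h : t ≤ 1 / 4) : step t = 0 :=
  Real.smoothTransition.zero_of_nonpos (by linarith)

theorem step_eq_one {t : ℝ} (h : 1 / 2 ≤ t) : step t = 1 :=
  Real.smoothTransition.one_of_one_le (by linarith)

theorem abs_step_le_one (t : ℝ) : |step t| ≤ 1 := by
  rw [step, abs_of_nonneg (Real.smoothTransition.nonneg _)]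
  exact Real.smoothTransition.le_one _

/-- The Yukawa potential, cut off outside a ball of radius `√2 ρ` and regularised inside a ball of
radius `δ`. -/
noncomputable def parametrix (k ρ δ s : ℝ) : ℝ :=
  step (s / δ ^ 2) * (step (1 - s / (4 * ρ ^ 2)) * yukawa k s)

section parametrix

variable {k ρ δ : ℝ}

theorem parametrix_eq_zero_of_lt (hδ : 0 < δ) {s : ℝ} (hs : s ≤ δ ^ 2 / 4) :
    parametrix k ρ δ s = 0 := by
  have : s / δ ^ 2 ≤ 1 / 4 := by rw [div_le_iff₀ (by positivity)]; linarith
  rw [parametrix, step_eq_zero this, zero_mul]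

theorem parametrix_eq_zero_of_ge (hρ : 0 < ρ) {s : ℝ} (hs : 3 * ρ ^ 2 ≤ s) :
    parametrix k ρ δ s = 0 := by
  have : 3 / 4 ≤ s / (4 * ρ ^ 2) := by rw [le_div_iff₀ (by positivity)]; linarith
  rw [parametrix, step_eq_zero (t := 1 - _) (by linarith), zero_mul, mul_zero]

theorem parametrix_eventuallyEq_zero (hδ : 0 < δ) {s : ℝ} (hs : s < δ ^ 2 / 4) :
    parametrix k ρ δ =ᶠ[𝓝 s] fun _ => 0 := by
  filter_upwards [eventually_lt_nhds hs] with t ht using parametrix_eq_zero_of_lt hδ ht.le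

theorem contDiff_parametrix (hδ : 0 < δ) : ContDiff ℝ ∞ (parametrix k ρ δ) := by
  rw [contDiff_iff_contDiffAt]
  intro s
  rcases lt_or_ge s (δ ^ 2 / 4) with hs | hs
  · exact contDiffAt_const.congr_of_eventuallyEq (parametrix_eventuallyEq_zero hδ hs)
  · have hs0 : 0 < s := lt_of_lt_of_le (by positivity) hs
    have h1 : ContDiff ℝ ∞ fun s => step (s / δ ^ 2) :=
      contDiff_step.comp (contDiff_id.div_const _)
    have h2 : ContDiff ℝ ∞ fun s => step (1 - s / (4 * ρ ^ 2)) :=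
      contDiff_step.comp (contDiff_const.sub (contDiff_id.div_const _))
    exact h1.contDiffAt.mul (h2.contDiffAt.mul (contDiffAt_yukawa k hs0))

theorem parametrix_eventuallyEq_mul_yukawa (hρ : 0 < ρ) {s : ℝ} (hs : s < 2 * ρ ^ 2) :
    parametrix k ρ δ =ᶠ[𝓝 s] fun t => step (t / δ ^ 2) * yukawa k t := by
  filter_upwards [eventually_lt_nhds hs] with t ht
  have : t / (4 * ρ ^ 2) ≤ 1 / 2 := by rw [div_le_iff₀ (by positivity)]; linarith
  rw [parametrix, step_eq_one (t := 1 - _) (by linarith), one_mul]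

theorem parametrix_eventuallyEq_yukawa (hρ : 0 < ρ) (hδ : 0 < δ) {s : ℝ} (hs : s < 2 * ρ ^ 2)
    (hs' : δ ^ 2 / 2 < s) : parametrix k ρ δ =ᶠ[𝓝 s] yukawa k := by
  filter_upwards [parametrix_eventuallyEq_mul_yukawa hρ hs, eventually_gt_nhds hs'] with t h1 h2
  have : 1 / 2 ≤ t / δ ^ 2 := by rw [le_div_iff₀ (by positivity)]; linarith
  rw [h1, step_eq_one this, one_mul]

theorem parametrix_eventuallyEq_parametrix {δ' : ℝ} (hδ : 0 < δ) (hδ' : 0 < δ') {s : ℝ}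
    (hs : δ ^ 2 / 2 < s) (hs' : δ' ^ 2 / 2 < s) :
    parametrix k ρ δ =ᶠ[𝓝 s] parametrix k ρ δ' := by
  filter_upwards [eventually_gt_nhds hs, eventually_gt_nhds hs'] with t h1 h2
  have h1 : 1 / 2 ≤ t / δ ^ 2 := by rw [le_div_iff₀ (by positivity)]; linarith
  have h2 : 1 / 2 ≤ t / δ' ^ 2 := by rw [le_div_iff₀ (by positivity)]; linarith
  rw [parametrix, parametrix, step_eq_one h1, step_eq_one h2]

theorem radialOp_parametrix_of_lt (hρ : 0 < ρ) (hδ : 0 < δ) {s : ℝ} (hs : s < 2 * ρ ^ 2)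
    (hs' : δ ^ 2 / 2 < s) : radialOp k (parametrix k ρ δ) s = 0 := by
  rw [radialOp_congr (parametrix_eventuallyEq_yukawa hρ hδ hs hs'),
    radialOp_yukawa k (lt_trans (by positivity) hs')]

theorem abs_yukawa_le (hk : 0 ≤ k) (s : ℝ) : |yukawa k s| ≤ 1 / √s := by
  rw [yukawa, abs_div, abs_of_nonneg (Real.sqrt_nonneg s), Real.abs_exp]
  gcongr
  rw [Real.exp_le_one_iff]
  nlinarith [Real.sqrt_nonneg s]

theorem abs_yukawaDeriv_le (hk : 0 ≤ k) (s : ℝ) :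
    |yukawaDeriv k s| ≤ (k / √s ^ 2 + 1 / √s ^ 3) / 2 := by
  have h0 : 0 ≤ k / √s ^ 2 + 1 / √s ^ 3 := by positivity
  have h1 : Real.exp (-k * √s) ≤ 1 := by
    rw [Real.exp_le_one_iff]
    nlinarith [Real.sqrt_nonneg s]
  rw [yukawaDeriv, abs_div, abs_mul, abs_neg, abs_of_nonneg h0, Real.abs_exp, abs_two]
  gcongr
  exact mul_le_of_le_one_right h0 h1

/-- The smooth part of `(Δ - k²)` applied to the parametrix, supported away from the origin. -/
noncomputable def remainder (k ρ s : ℝ) : ℝ :=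
  step (s / ρ ^ 2) * radialOp k (parametrix k ρ (ρ / 2)) s

theorem contDiff_remainder (hρ : 0 < ρ) : ContDiff ℝ ∞ (remainder k ρ) :=
  (contDiff_step.comp (contDiff_id.div_const _)).mul
    (contDiff_radialOp (contDiff_parametrix (by positivity)))

theorem remainder_eq_zero_of_lt (hρ : 0 < ρ) {s : ℝ} (hs : s ≤ ρ ^ 2 / 4) :
    remainder k ρ s = 0 := by
  have : s / ρ ^ 2 ≤ 1 / 4 := by rw [div_le_iff₀ (by positivity)]; linarith
  rw [remainder, step_eq_zero this, zero_mul]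

theorem remainder_eq_zero_of_gt (hρ : 0 < ρ) {s : ℝ} (hs : 3 * ρ ^ 2 < s) :
    remainder k ρ s = 0 := by
  have : parametrix k ρ (ρ / 2) =ᶠ[𝓝 s] fun _ => 0 := by
    filter_upwards [eventually_gt_nhds hs] with t ht using parametrix_eq_zero_of_ge hρ ht.le
  rw [remainder, radialOp_congr this]
  simp [radialOp]

/-- Beyond radius `δ` the inner cutoff is inactive. Where the outer cutoff is inactive too, the
Yukawa potential is an exact solution and both sides vanish; farther out the parametrix does not
depend on `δ`, so the reference choice `ρ / 2` in `remainder` is harmless. -/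
theorem radialOp_parametrix_eq_remainder (hρ : 0 < ρ) (hδ : 0 < δ) {s : ℝ}
    (hs : δ ^ 2 ≤ s) : radialOp k (parametrix k ρ δ) s = remainder k ρ s := by
  have hd : δ ^ 2 / 2 < s := by nlinarith [pow_pos hδ 2]
  have hρ2 : 0 < ρ ^ 2 := by positivity
  rcases le_or_gt s (ρ ^ 2 / 4) with h1 | h1
  · rw [remainder_eq_zero_of_lt hρ h1, radialOp_parametrix_of_lt hρ hδ (by nlinarith) hd]
  · have hd' : (ρ / 2) ^ 2 / 2 < s := by nlinarith
    rw [radialOp_congr (parametrix_eventuallyEq_parametrix hδ (half_pos hρ) hd hd'), remainder]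
    rcases le_or_gt s (ρ ^ 2 / 2) with h2 | h2
    · rw [radialOp_parametrix_of_lt hρ (half_pos hρ) (by nlinarith) hd', mul_zero]
    · have : 1 / 2 ≤ s / ρ ^ 2 := by rw [le_div_iff₀ (by positivity)]; linarith
      rw [step_eq_one this, one_mul]

/-- The rate `δ⁻³` is the reciprocal of the volume scale of the ball of radius `δ`, as for an
approximate identity. It comes from `s ≤ δ²`, derivatives of the cutoff of order `δ⁻²` and `δ⁻⁴`,
and `yukawa`, `yukawaDeriv` of order `δ⁻¹` and `δ⁻³`. -/
theorem exists_abs_radialOp_parametrix_le (hk : 0 ≤ k) (hρ : 0 < ρ) :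
    ∃ C, 0 ≤ C ∧ ∀ δ, 0 < δ → δ ≤ ρ / 2 → ∀ s, s ≤ δ ^ 2 →
      |radialOp k (parametrix k ρ δ) s| ≤ C / δ ^ 3 := by
  have c1 : ContDiff ℝ ∞ (deriv step) := (contDiff_infty_iff_deriv.1 contDiff_step).2
  have c2 : ContDiff ℝ ∞ (deriv (deriv step)) := (contDiff_infty_iff_deriv.1 c1).2
  obtain ⟨M1, hM1⟩ := (isCompact_Icc (a := (0 : ℝ)) (b := 1)).exists_bound_of_continuousOn
    c1.continuous.continuousOn
  obtain ⟨M2, hM2⟩ := (isCompact_Icc (a := (0 : ℝ)) (b := 1)).exists_bound_of_continuousOn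
    c2.continuous.continuousOn
  have hM10 : 0 ≤ M1 := (norm_nonneg _).trans (hM1 0 (by simp))
  have hM20 : 0 ≤ M2 := (norm_nonneg _).trans (hM2 0 (by simp))
  refine ⟨8 * M2 + 8 * M1 * (2 * k * ρ + 4) + 12 * M1, by positivity, fun δ hδ hδρ s hs => ?_⟩
  rcases lt_or_ge s (δ ^ 2 / 4) with h | h
  · rw [radialOp_congr (parametrix_eventuallyEq_zero hδ h)]
    simp only [radialOp, deriv_const', mul_zero, add_zero, sub_zero, abs_zero]
    positivity
  have hδ2 : 0 < δ ^ 2 := by positivity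
  have hs0 : 0 < s := lt_of_lt_of_le (by positivity) h
  have hsρ : s < 2 * ρ ^ 2 := by nlinarith
  have hT : ContDiff ℝ ∞ (fun t => step (t / δ ^ 2)) :=
    contDiff_step.comp (contDiff_id.div_const _)
  have hd1 : ∀ t, HasDerivAt (fun t => step (t / δ ^ 2)) (deriv step (t / δ ^ 2) / δ ^ 2) t :=
    fun t => by
      have := ((contDiff_step.differentiable (by simp)).differentiableAt
        (x := t / δ ^ 2)).hasDerivAt.comp t ((hasDerivAt_id t).div_const (δ ^ 2))
      simpa [Function.comp_def, div_eq_mul_inv] using this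
  have hd2 : deriv (deriv fun t => step (t / δ ^ 2)) s
      = deriv (deriv step) (s / δ ^ 2) / δ ^ 2 / δ ^ 2 := by
    rw [show (deriv fun t => step (t / δ ^ 2)) = fun t => deriv step (t / δ ^ 2) / δ ^ 2 from
      funext fun t => (hd1 t).deriv]
    have := ((c1.differentiable (by simp)).differentiableAt
        (x := s / δ ^ 2)).hasDerivAt.comp s ((hasDerivAt_id s).div_const (δ ^ 2))
    have := (this.div_const (δ ^ 2)).deriv
    simpa [Function.comp_def, div_eq_mul_inv] using this
  have hmem : s / δ ^ 2 ∈ Set.Icc (0 : ℝ) 1 :=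
    ⟨by positivity, by rw [div_le_one hδ2]; exact hs⟩
  have hr1 : δ / 2 ≤ √s := Real.le_sqrt_of_sq_le (by nlinarith)
  have hq : |yukawa k s| ≤ 2 / δ := (abs_yukawa_le hk s).trans <| by
    calc 1 / √s ≤ 1 / (δ / 2) := by gcongr
      _ = 2 / δ := by field_simp
  have hq1 : |yukawaDeriv k s| ≤ (2 * k * ρ + 4) / δ ^ 3 := (abs_yukawaDeriv_le hk s).trans <| by
    calc (k / √s ^ 2 + 1 / √s ^ 3) / 2 ≤ (k / (δ / 2) ^ 2 + 1 / (δ / 2) ^ 3) / 2 := by gcongr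
      _ = (2 * k * δ + 4) / δ ^ 3 := by field_simp; ring
      _ ≤ (2 * k * ρ + 4) / δ ^ 3 := by gcongr; linarith
  have b1 : |deriv step (s / δ ^ 2)| ≤ M1 := hM1 _ hmem
  have b2 : |deriv (deriv step) (s / δ ^ 2)| ≤ M2 := hM2 _ hmem
  rw [radialOp_congr (parametrix_eventuallyEq_mul_yukawa hρ hsρ), radialOp_mul_yukawa k hs0 hT,
    hd2, (hd1 s).deriv]
  calc _ ≤ 4 * s * (|deriv (deriv step) (s / δ ^ 2)| / δ ^ 2 / δ ^ 2) * |yukawa k s|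
        + 8 * s * (|deriv step (s / δ ^ 2)| / δ ^ 2) * |yukawaDeriv k s|
        + 6 * (|deriv step (s / δ ^ 2)| / δ ^ 2) * |yukawa k s| := by
        refine (abs_add_le _ _).trans (add_le_add ((abs_add_le _ _).trans_eq ?_) (le_of_eq ?_))
        · simp only [abs_mul, abs_div, abs_of_pos hs0, abs_of_pos hδ2]
          norm_num
        · simp only [abs_mul, abs_div, abs_of_pos hδ2]
          norm_num
    _ ≤ 4 * δ ^ 2 * (M2 / δ ^ 2 / δ ^ 2) * (2 / δ)
        + 8 * δ ^ 2 * (M1 / δ ^ 2) * ((2 * k * ρ + 4) / δ ^ 3)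
        + 6 * (M1 / δ ^ 2) * (2 / δ) := by gcongr
    _ = _ := by field_simp; ring

end parametrix

/-- The concentrating part of `(Δ - k²)` applied to the parametrix, supported in `s ≤ δ²`. -/
noncomputable def core (k ρ δ s : ℝ) : ℝ :=
  radialOp k (parametrix k ρ δ) s - remainder k ρ s

section core

variable {k ρ δ : ℝ}

theorem core_eq_zero (hρ : 0 < ρ) (hδ : 0 < δ) {s : ℝ} (hs : δ ^ 2 ≤ s) : core k ρ δ s = 0 := by
  rw [core, radialOp_parametrix_eq_remainder hρ hδ hs, sub_self]

theorem core_eq_radialOp (hρ : 0 < ρ) (hδ : 0 < δ) (hδρ : δ ≤ ρ / 2) {s : ℝ} (hs : s ≤ δ ^ 2) :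
    core k ρ δ s = radialOp k (parametrix k ρ δ) s := by
  rw [core, remainder_eq_zero_of_lt hρ (by nlinarith), sub_zero]

theorem contDiff_core (hρ : 0 < ρ) (hδ : 0 < δ) : ContDiff ℝ ∞ (core k ρ δ) :=
  (contDiff_radialOp (contDiff_parametrix hδ)).sub (contDiff_remainder hρ)

theorem abs_parametrix_le (hk : 0 ≤ k) (s : ℝ) : |parametrix k ρ δ s| ≤ 1 / √s := by
  rw [parametrix, abs_mul, abs_mul]
  have h1 := abs_step_le_one (s / δ ^ 2)
  have h2 := abs_step_le_one (1 - s / (4 * ρ ^ 2))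
  have h3 := abs_yukawa_le hk s
  have h4 : 0 ≤ |yukawa k s| := abs_nonneg _
  calc _ ≤ 1 * (1 * |yukawa k s|) := by gcongr
    _ ≤ 1 / √s := by simpa using h3

/-- This is the divergence theorem in radial form: `y²` times the second-order part is the
derivative of `2y³F'(y²)`. The boundary term at `0` vanishes, and the one at `δ` is explicit because
the parametrix equals `yukawa` there. -/
theorem integral_sq_mul_radialOp_parametrix (hρ : 0 < ρ) (hδ : 0 < δ) (hδρ : δ ≤ ρ / 2) :
    ∫ y in (0 : ℝ)..δ, y ^ 2 * radialOp k (parametrix k ρ δ) (y ^ 2)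
      = -(k * δ + 1) * Real.exp (-k * δ)
        - ∫ y in (0 : ℝ)..δ, k ^ 2 * (y ^ 2 * parametrix k ρ δ (y ^ 2)) := by
  have hF := contDiff_parametrix (k := k) (ρ := ρ) hδ
  set F := parametrix k ρ δ with hFdef
  have hF1 : ContDiff ℝ ∞ (deriv F) := (contDiff_infty_iff_deriv.1 hF).2
  have hF2 : ContDiff ℝ ∞ (deriv (deriv F)) := (contDiff_infty_iff_deriv.1 hF1).2
  have hder : ∀ y : ℝ, HasDerivAt (fun y => 2 * y ^ 3 * deriv F (y ^ 2))
      (y ^ 2 * (4 * y ^ 2 * deriv (deriv F) (y ^ 2) + 6 * deriv F (y ^ 2))) y := fun y => by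
    have h1 := ((hF1.differentiable (by simp)).differentiableAt
      (x := y ^ 2)).hasDerivAt.comp y (hasDerivAt_pow 2 y)
    have h2 := ((hasDerivAt_pow 3 y).const_mul 2).mul h1
    refine h2.congr_deriv ?_
    simp only [Function.comp_def]
    push_cast
    ring
  have c1 := hF.continuous
  have c2 := hF1.continuous
  have c3 := hF2.continuous
  have e := intervalIntegral.integral_eq_sub_of_hasDerivAt (a := 0) (b := δ)
    (fun y _ => hder y) (Continuous.intervalIntegrable (by fun_prop) _ _)
  have hyd : deriv F (δ ^ 2) = yukawaDeriv k (δ ^ 2) := by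
    rw [(parametrix_eventuallyEq_yukawa hρ hδ (by nlinarith) (by nlinarith)).deriv_eq,
      deriv_yukawa k (by positivity)]
  have hsq : √(δ ^ 2) = δ := Real.sqrt_sq hδ.le
  have hb : 2 * δ ^ 3 * deriv F (δ ^ 2) = -(k * δ + 1) * Real.exp (-k * δ) := by
    rw [hyd, yukawaDeriv, hsq]
    field_simp
  rw [hb, zero_pow three_ne_zero, mul_zero, zero_mul, sub_zero] at e
  rw [← e, ← intervalIntegral.integral_sub
    (Continuous.intervalIntegrable (by fun_prop) _ _)
    (Continuous.intervalIntegrable (by fun_prop) _ _)]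
  refine intervalIntegral.integral_congr fun y _ => ?_
  simp only [radialOp]
  ring

theorem integral_core (hρ : 0 < ρ) (hδ : 0 < δ) (hδρ : δ ≤ ρ / 2) :
    ∫ x : E3, core k ρ δ (‖x‖ ^ 2) = 3 * volume.real (Metric.ball (0 : E3) 1) *
      (-(k * δ + 1) * Real.exp (-k * δ)
        - ∫ y in (0 : ℝ)..δ, k ^ 2 * (y ^ 2 * parametrix k ρ δ (y ^ 2))) := by
  rw [← integral_sq_mul_radialOp_parametrix hρ hδ hδρ,
    integral_fun_norm_addHaar volume (fun r => core k ρ δ (r ^ 2)),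
    setIntegral_eq_of_subset_of_forall_sdiff_eq_zero measurableSet_Ioi
      (Set.Ioc_subset_Ioi_self : Set.Ioc 0 δ ⊆ Set.Ioi 0),
    intervalIntegral.integral_of_le hδ.le]
  · simp only [finrank_euclideanSpace, Fintype.card_fin, nsmul_eq_mul, smul_eq_mul]
    push_cast
    rw [mul_assoc]
    congr 2
    refine setIntegral_congr_fun measurableSet_Ioc fun y hy => ?_
    rw [core_eq_radialOp hρ hδ hδρ (by nlinarith [hy.1, hy.2])]
  · intro y hy
    have h1 : 0 < y := hy.1
    have h2 : δ < y := by
      by_contra h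
      exact hy.2 ⟨h1, not_lt.1 h⟩
    rw [core_eq_zero hρ hδ (by nlinarith), smul_zero]

/-- The total mass tends to minus the area `3V` of the unit sphere, `V` being the volume of the unit
ball: the flux term tends to `-1`, and the zeroth-order term is at most `k²δ²`. -/
theorem tendsto_integral_core (hk : 0 ≤ k) (hρ : 0 < ρ) :
    Tendsto (fun δ => ∫ x : E3, core k ρ δ (‖x‖ ^ 2)) (𝓝[>] 0)
      (𝓝 (-(3 * volume.real (Metric.ball (0 : E3) 1)))) := by
  have hev : ∀ᶠ δ in 𝓝[>] (0 : ℝ), 0 < δ ∧ δ ≤ ρ / 2 :=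
    (eventually_mem_nhdsWithin).and (mem_nhdsWithin_of_mem_nhds (Iic_mem_nhds (by positivity)))
  have h1 : Tendsto (fun δ => -(k * δ + 1) * Real.exp (-k * δ)) (𝓝[>] 0) (𝓝 (-1)) := by
    have : Continuous fun δ => -(k * δ + 1) * Real.exp (-k * δ) := by fun_prop
    simpa using (this.tendsto 0).mono_left nhdsWithin_le_nhds
  have h2 : Tendsto (fun δ => ∫ y in (0 : ℝ)..δ, k ^ 2 * (y ^ 2 * parametrix k ρ δ (y ^ 2)))
      (𝓝[>] 0) (𝓝 0) := by
    have hb : Tendsto (fun δ : ℝ => k ^ 2 * δ * |δ - 0|) (𝓝[>] 0) (𝓝 0) := by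
      have : Continuous fun δ : ℝ => k ^ 2 * δ * |δ - 0| := by fun_prop
      simpa using (this.tendsto 0).mono_left nhdsWithin_le_nhds
    refine squeeze_zero_norm' ?_ hb
    filter_upwards [hev] with δ hδ
    refine intervalIntegral.norm_integral_le_of_norm_le_const fun y hy => ?_
    rw [Set.uIoc_of_le hδ.1.le] at hy
    have hy0 : 0 < y := hy.1
    have := abs_parametrix_le (ρ := ρ) (δ := δ) hk (y ^ 2)
    rw [Real.sqrt_sq hy0.le] at this
    rw [Real.norm_eq_abs, abs_mul, abs_mul, abs_of_nonneg (sq_nonneg k),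
      abs_of_nonneg (sq_nonneg y)]
    gcongr
    calc y ^ 2 * |parametrix k ρ δ (y ^ 2)| ≤ y ^ 2 * (1 / y) := by gcongr
      _ = y := by field_simp
      _ ≤ δ := hy.2
  have h3 := (h1.sub h2).const_mul (3 * volume.real (Metric.ball (0 : E3) 1))
  rw [sub_zero, mul_neg_one] at h3
  refine h3.congr' ?_
  filter_upwards [hev] with δ hδ
  rw [integral_core hρ hδ.1 hδ.2]

end core

theorem continuous_radial {G : ℝ → ℝ} (hG : Continuous G) (x : E3) :
    Continuous fun y : E3 => G (‖y - x‖ ^ 2) := by fun_prop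

theorem hasCompactSupport_radial {G : ℝ → ℝ} {c : ℝ} (hG : ∀ s, c < s → G s = 0) (x : E3) :
    HasCompactSupport fun y : E3 => G (‖y - x‖ ^ 2) := by
  refine HasCompactSupport.intro (isCompact_closedBall x √c) fun y hy => hG _ ?_
  rw [Metric.mem_closedBall, dist_eq_norm, not_le] at hy
  exact Real.lt_sq_of_sqrt_lt hy

theorem integrable_mul_radial {u : E3 → ℝ} (hu : LocallyIntegrable u) {G : ℝ → ℝ} {c : ℝ}
    (hc : Continuous G) (hG : ∀ s, c < s → G s = 0) (x : E3) :
    Integrable fun y : E3 => u y * G (‖y - x‖ ^ 2) := by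
  simpa [mul_comm] using hu.integrable_smul_left_of_hasCompactSupport
    (continuous_radial hc x) (hasCompactSupport_radial hG x)

/-- The kernel lives on the ball of radius `δ` and is at most `C / δ³` there, so the integral is
bounded by a constant times the mean oscillation of `u`, which is assumed to vanish at `x`. -/
theorem tendsto_integral_core_sub {u : E3 → ℝ} (hu : LocallyIntegrable u) {k ρ : ℝ} (hk : 0 ≤ k)
    (hρ : 0 < ρ) {x : E3}
    (hx : Tendsto (fun δ => ⨍ y in Metric.closedBall x δ, ‖u y - u x‖) (𝓝[>] 0) (𝓝 0)) :
    Tendsto (fun δ => ∫ y, (u y - u x) * core k ρ δ (‖y - x‖ ^ 2)) (𝓝[>] 0) (𝓝 0) := by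
  obtain ⟨C, hC0, hC⟩ := exists_abs_radialOp_parametrix_le hk hρ
  have hev : ∀ᶠ δ in 𝓝[>] (0 : ℝ), 0 < δ ∧ δ ≤ ρ / 2 :=
    (eventually_mem_nhdsWithin).and (mem_nhdsWithin_of_mem_nhds (Iic_mem_nhds (by positivity)))
  have hb := hx.const_mul (C * volume.real (Metric.closedBall (0 : E3) 1))
  rw [mul_zero] at hb
  refine squeeze_zero_norm' ?_ hb
  filter_upwards [hev] with δ ⟨hδ, hδρ⟩
  have hz : ∀ y, y ∉ Metric.closedBall x δ → (u y - u x) * core k ρ δ (‖y - x‖ ^ 2) = 0 := by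
    intro y hy
    rw [Metric.mem_closedBall, dist_eq_norm, not_le] at hy
    rw [core_eq_zero hρ hδ (by nlinarith), mul_zero]
  rw [← setIntegral_eq_integral_of_forall_compl_eq_zero hz, setAverage_eq,
    Measure.addHaar_real_closedBall' _ _ hδ.le, finrank_euclideanSpace, Fintype.card_fin]
  have hpos : 0 < volume.real (Metric.closedBall (0 : E3) 1) := by
    exact ENNReal.toReal_pos (Metric.measure_closedBall_pos _ _ one_pos).ne'
      measure_closedBall_lt_top.ne
  have hint : IntegrableOn (fun y => ‖u y - u x‖) (Metric.closedBall x δ) :=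
    ((hu.integrableOn_isCompact (isCompact_closedBall x δ)).sub
      (integrableOn_const measure_closedBall_lt_top.ne)).norm
  calc _ ≤ ∫ y in Metric.closedBall x δ, ‖u y - u x‖ * (C / δ ^ 3) := by
        refine norm_integral_le_of_norm_le (hint.mul_const _) ?_
        refine (ae_restrict_iff' measurableSet_closedBall).2 (Eventually.of_forall fun y hy => ?_)
        rw [Metric.mem_closedBall, dist_eq_norm] at hy
        have hs : ‖y - x‖ ^ 2 ≤ δ ^ 2 := by gcongr
        rw [norm_mul, core_eq_radialOp hρ hδ hδρ hs]
        gcongr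
        exact hC δ hδ hδρ _ hs
    _ = _ := by
        rw [integral_mul_const, smul_eq_mul]
        field_simp

/-- Weyl's lemma: a locally integrable distributional solution of `Δu = k²u` is smooth. -/
theorem exists_contDiff_of_integral_lap {u : E3 → ℝ} {x₀ : E3} {R k : ℝ} (hR : 0 < R)
    (hk : 0 ≤ k) (hu : LocallyIntegrable u)
    (h : ∀ φ, IsTestFunction (Metric.ball x₀ R) φ →
      ∫ x, u x * lap φ x = k ^ 2 * ∫ x, u x * φ x) :
    ∃ w : E3 → ℝ, ContDiff ℝ 2 w ∧ ∀ᵐ x, x ∈ Metric.ball x₀ (R / 2) → u x = w x := by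
  -- The parametrix has support radius at most `√3 ρ < 2ρ = R / 2`; centred in the half ball, it is
  -- a test function on the full ball.
  set ρ := R / 4 with hρdef
  have hρ : 0 < ρ := by positivity
  set V := volume.real (Metric.ball (0 : E3) 1)
  have hV : 0 < V := by
    exact ENNReal.toReal_pos (Metric.measure_ball_pos _ _ one_pos).ne' measure_ball_lt_top.ne
  have hrem := contDiff_remainder (k := k) hρ
  have hremc : ∀ s, 3 * ρ ^ 2 < s → remainder k ρ s = 0 := fun s => remainder_eq_zero_of_gt hρ
  refine ⟨fun x => (∫ y, u y * remainder k ρ (‖y - x‖ ^ 2)) / (3 * V), ?_, ?_⟩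
  · have hg : ContDiff ℝ 2 fun y : E3 => remainder k ρ (‖y - 0‖ ^ 2) :=
      (contDiff_infty.1 hrem 2).comp ((contDiff_id.sub contDiff_const).norm_sq ℝ)
    have := (hasCompactSupport_radial hremc 0).contDiff_convolution_right
      (ContinuousLinearMap.mul ℝ ℝ) hu hg (n := 2)
    have e : (fun x => ∫ y, u y * remainder k ρ (‖y - x‖ ^ 2))
        = convolution u (fun y => remainder k ρ (‖y - 0‖ ^ 2))
          (ContinuousLinearMap.mul ℝ ℝ) volume := by
      funext x
      simp only [convolution, ContinuousLinearMap.mul_apply', sub_zero, norm_sub_rev x]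
    rw [← e] at this
    exact this.div_const _
  · have hleb := IsUnifLocDoublingMeasure.ae_tendsto_average_norm_sub volume hu 0
    filter_upwards [hleb] with x hx hxB
    have hx' := hx (fun _ => x) (fun δ => δ) (l := 𝓝[>] (0 : ℝ)) tendsto_id
      (Eventually.of_forall fun δ => by simp)
    have hev : ∀ᶠ δ in 𝓝[>] (0 : ℝ), 0 < δ ∧ δ ≤ ρ / 2 :=
      (eventually_mem_nhdsWithin).and
        (mem_nhdsWithin_of_mem_nhds (Iic_mem_nhds (by positivity)))
    have h1 := tendsto_integral_core_sub hu hk hρ hx'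
    have h2 := ((tendsto_integral_core hk hρ).const_mul (u x)).add h1
    -- Testing the equation with the parametrix centred at `x` gives that `core` and `remainder`
    -- integrate against `u` to zero; the `core` integral is then split into its mass times `u x`
    -- and an oscillation term. The right side is independent of `δ`.
    have h3 : ∀ᶠ δ in 𝓝[>] (0 : ℝ), u x * (∫ y : E3, core k ρ δ (‖y‖ ^ 2))
        + ∫ y, (u y - u x) * core k ρ δ (‖y - x‖ ^ 2)
        = -∫ y, u y * remainder k ρ (‖y - x‖ ^ 2) := by
      filter_upwards [hev] with δ ⟨hδ, hδρ⟩
      have hF := contDiff_parametrix (k := k) (ρ := ρ) hδ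
      have hFc : ∀ s, 3 * ρ ^ 2 < s → parametrix k ρ δ s = 0 :=
        fun s hs => parametrix_eq_zero_of_ge hρ hs.le
      have hsub : Metric.closedBall x √(3 * ρ ^ 2) ⊆ Metric.ball x₀ R := by
        have : √(3 * ρ ^ 2) ≤ 2 * ρ := Real.sqrt_le_iff.2 ⟨by positivity, by nlinarith⟩
        refine (Metric.closedBall_subset_closedBall this).trans fun y hy => ?_
        rw [Metric.mem_ball] at hxB ⊢
        rw [Metric.mem_closedBall] at hy
        linarith [dist_triangle y x x₀]
      have hφ : IsTestFunction (Metric.ball x₀ R) fun y => parametrix k ρ δ (‖y - x‖ ^ 2) := by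
        refine ⟨hF.comp ((contDiff_id.sub contDiff_const).norm_sq ℝ),
          hasCompactSupport_radial hFc x,
          (closure_minimal ?_ Metric.isClosed_closedBall).trans hsub⟩
        intro y hy
        by_contra h'
        rw [Metric.mem_closedBall, dist_eq_norm, not_le] at h'
        exact hy (hFc _ (Real.lt_sq_of_sqrt_lt h'))
      have hcore : ∀ s, δ ^ 2 < s → core k ρ δ s = 0 := fun s hs => core_eq_zero hρ hδ hs.le
      have hcc := (contDiff_core (k := k) hρ hδ).continuous
      have e1 := h _ hφ
      have e2 : ∫ y, (u y * core k ρ δ (‖y - x‖ ^ 2) + u y * remainder k ρ (‖y - x‖ ^ 2)) = 0 := by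
        have i1 : Integrable fun y => u y * lap (fun y => parametrix k ρ δ (‖y - x‖ ^ 2)) y := by
          simp only [lap, Finset.mul_sum]
          refine integrable_finsetSum _ fun i _ => ?_
          have ht := ((hφ.fderiv_apply (stdVec i)).fderiv_apply (stdVec i))
          simpa [mul_comm] using
            hu.integrable_smul_left_of_hasCompactSupport ht.continuous ht.2.1
        rw [← integral_const_mul, ← sub_eq_zero, ← integral_sub i1
          ((integrable_mul_radial hu hF.continuous hFc x).const_mul _)] at e1
        rw [← e1]
        refine integral_congr_ae (Eventually.of_forall fun y => ?_)
        simp only [lap_radial hF, core, radialOp]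
        ring
      rw [integral_add (integrable_mul_radial hu hcc hcore x)
        (integrable_mul_radial hu hrem.continuous hremc x)] at e2
      have e3 : ∫ y, (u y - u x) * core k ρ δ (‖y - x‖ ^ 2)
          = (∫ y, u y * core k ρ δ (‖y - x‖ ^ 2)) - u x * ∫ y : E3, core k ρ δ (‖y‖ ^ 2) := by
        simp only [sub_mul]
        rw [integral_sub (integrable_mul_radial hu hcc hcore x)
          (((continuous_radial hcc x).integrable_of_hasCompactSupport
            (hasCompactSupport_radial hcore x)).const_mul _), integral_const_mul,
          integral_sub_right_eq_self (fun y : E3 => core k ρ δ (‖y‖ ^ 2)) x]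
      rw [e3]
      linarith
    have h4 := tendsto_nhds_unique (h2.congr' h3) tendsto_const_nhds
    have : u x * (3 * V) = ∫ y, u y * remainder k ρ (‖y - x‖ ^ 2) := by linarith
    rw [← this]
    field_simp

/-! ### Blow-up at a regular interface point -/

/-- Otherwise the indicator of the half-space, mollified by a bump, would have zero derivative along
`v`. But it changes from a positive constant to `0` along the line `ℝ v`, which crosses the boundary
plane transversally. -/
theorem exists_integral_halfSpace_fderiv_ne_zero {ν v : E3} (hν : ‖ν‖ = 1)
    (hv : inner ℝ ν v ≠ 0) :
    ∃ φ : E3 → ℝ, ContDiff ℝ ∞ φ ∧ HasCompactSupport φ ∧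
      ∫ z in {z : E3 | inner ℝ ν z < 0}, fderiv ℝ φ z v ≠ 0 := by
  by_contra! H
  let b : ContDiffBump (0 : E3) := ⟨1 / 2, 1, by norm_num, by norm_num⟩
  set A : Set E3 := {z | inner ℝ ν z < 0} with hA
  have hAm : MeasurableSet A :=
    (isOpen_lt (by fun_prop) continuous_const : IsOpen A).measurableSet
  set χ : E3 → ℝ := A.indicator fun _ => 1 with hχ
  have hχl : LocallyIntegrable χ := (locallyIntegrable_const 1).indicator hAm
  set L := ContinuousLinearMap.lsmul ℝ ℝ (E := ℝ)
  have hb1 : ContDiff ℝ ∞ b := b.contDiff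
  set G : E3 → ℝ := convolution χ b L volume with hG
  have hGd : ∀ y, HasFDerivAt G (convolution χ (fderiv ℝ b) (L.precompR E3) volume y) y :=
    b.hasCompactSupport.hasFDerivAt_convolution_right L hχl (hb1.of_le (by simp))
  have hz : ∀ y, convolution χ (fderiv ℝ b) (L.precompR E3) volume y v = 0 := by
    intro y
    rw [convolution_precompR_apply _ hχl (b.hasCompactSupport.fderiv (𝕜 := ℝ))
      (hb1.continuous_fderiv (by simp))]
    have hφ : ContDiff ℝ ∞ fun t => b (y - t) := hb1.comp (contDiff_const.sub contDiff_id)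
    have hφc : HasCompactSupport fun t => b (y - t) :=
      b.hasCompactSupport.comp_homeomorph (Homeomorph.subLeft y)
    have hfd : ∀ t, fderiv ℝ (fun t => b (y - t)) t v = -fderiv ℝ b (y - t) v := fun t => by
      have h1 := ((hb1.differentiable (by simp)).differentiableAt
        (x := y - t)).hasFDerivAt.comp t ((hasFDerivAt_id t).const_sub y)
      have h2 := h1.fderiv
      simp only [Function.comp_def] at h2
      rw [h2]
      simp
    have := H _ hφ hφc
    simp_rw [hfd, integral_neg, neg_eq_zero] at this
    rw [← this, convolution, ← integral_indicator hAm]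
    refine integral_congr_ae (Eventually.of_forall fun t => ?_)
    by_cases ht : t ∈ A <;> simp [L, χ, ht]
  have hconst : ∀ s t : ℝ, G (s • v) = G (t • v) := by
    have hd : ∀ t : ℝ, HasDerivAt (fun t : ℝ => G (t • v)) 0 t := fun t => by
      have h1 := (hGd (t • v)).comp_hasDerivAt t ((hasDerivAt_id t).smul_const v)
      simpa [Function.comp_def, hz] using h1
    exact is_const_of_deriv_eq_zero (fun t => (hd t).differentiableAt) fun t => (hd t).deriv
  -- With this choice `T • v` and `-T • v` lie at distance `1`, the outer radius of the bump, on
  -- opposite sides of the plane, so each translated bump sees only one side.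
  set T : ℝ := -(inner ℝ ν v)⁻¹ with hT
  have hnear : ∀ (s : ℝ) (t : E3), b (s • v - t) ≠ 0 → |s * inner ℝ ν v - inner ℝ ν t| < 1 := by
    intro s t hne
    have h1 : s • v - t ∈ Metric.ball (0 : E3) 1 := by
      have : s • v - t ∈ Function.support b := hne
      rwa [b.support_eq] at this
    rw [mem_ball_zero_iff] at h1
    calc |s * inner ℝ ν v - inner ℝ ν t| = |inner ℝ ν (s • v - t)| := by
          rw [inner_sub_right, inner_smul_right]
      _ ≤ ‖ν‖ * ‖s • v - t‖ := abs_real_inner_le_norm _ _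
      _ < 1 := by rwa [hν, one_mul]
  have hTv : T * inner ℝ ν v = -1 := by rw [hT]; field_simp
  have hTv' : -T * inner ℝ ν v = 1 := by linarith
  have e1 : G (T • v) = ∫ z, b z := by
    rw [hG, convolution, ← integral_sub_left_eq_self (fun z => b z) volume (T • v)]
    refine integral_congr_ae (Eventually.of_forall fun t => ?_)
    by_cases hb : b (T • v - t) = 0
    · simp [L, hb]
    · have h1 := hnear T t hb
      rw [hTv, abs_lt] at h1
      have ht : t ∈ A := by
        change inner ℝ ν t < 0
        linarith
      simp [L, χ, ht]
  have e2 : G ((-T) • v) = 0 := by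
    rw [hG, convolution]
    refine (integral_congr_ae (Eventually.of_forall fun t => ?_)).trans (integral_zero _ _)
    by_cases hb : b ((-T) • v - t) = 0
    · simp only [hb, map_zero]
    · have h1 := hnear (-T) t hb
      rw [hTv', abs_lt] at h1
      have ht : t ∉ A := by
        change ¬ inner ℝ ν t < 0
        linarith
      simp [L, χ, ht]
  have := hconst T (-T)
  rw [e1, e2] at this
  exact b.integral_pos.ne' this

/-- Dominated convergence: each ray `x + ε z` off the tangent plane, which is a null set, eventually
stays in one of the two regions, where `h` has a limit. The codomain is general so that the vector
and scalar terms share the lemma. -/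
theorem tendsto_integral_inner_blowup {F : Type*} [NormedAddCommGroup F] [InnerProductSpace ℝ F]
    [MeasurableSpace F] [BorelSpace F] [SecondCountableTopology F]
    {A C : Set E3} {x ν : E3} {h Ψ : E3 → F} {α β : F} {K : ℝ} (hA : IsOpen A) (hC : IsOpen C)
    (hcA : ContinuousOn h A) (hcC : ContinuousOn h C) (hK : ∀ y ∈ A ∪ C, ‖h y‖ ≤ K)
    (tA : Tendsto h (𝓝[A] x) (𝓝 α)) (tC : Tendsto h (𝓝[C] x) (𝓝 β)) (hν : ν ≠ 0)
    (coneA : ∀ z, inner ℝ ν z < 0 → ∀ᶠ ε in 𝓝[>] (0 : ℝ), x + ε • z ∈ A)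
    (coneC : ∀ z, 0 < inner ℝ ν z → ∀ᶠ ε in 𝓝[>] (0 : ℝ), x + ε • z ∈ C)
    (hΨ : Integrable Ψ) :
    Tendsto (fun ε : ℝ => ∫ z, inner ℝ ((A ∪ C).indicator h (x + ε • z)) (Ψ z)) (𝓝[>] 0)
      (𝓝 (∫ z, inner ℝ (if inner ℝ ν z < 0 then α else β) (Ψ z))) := by
  classical
  have hAC : IsOpen (A ∪ C) := hA.union hC
  have hm : Measurable ((A ∪ C).indicator h) := by
    rw [← Set.piecewise_eq_indicator]
    exact (hcA.union_of_isOpen hcC hA hC).measurable_piecewise continuousOn_const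
      hAC.measurableSet
  have hplane : ∀ᵐ z : E3, inner ℝ ν z ≠ 0 := by
    have hs : (LinearMap.ker (innerSL ℝ ν).toLinearMap) ≠ ⊤ := by
      intro htop
      have : ν ∈ LinearMap.ker (innerSL ℝ ν).toLinearMap := htop ▸ Submodule.mem_top
      simp [hν] at this
    have := Measure.addHaar_submodule volume _ hs
    filter_upwards [measure_eq_zero_iff_ae_notMem.1 this] with z hz h0
    exact hz (by simpa using h0)
  have htend : ∀ z : E3, Tendsto (fun ε : ℝ => x + ε • z) (𝓝[>] 0) (𝓝 x) := fun z => by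
    have : Continuous fun ε : ℝ => x + ε • z := by fun_prop
    simpa using (this.tendsto 0).mono_left nhdsWithin_le_nhds
  have hlim : ∀ (S : Set E3) (γ : F) (z : E3), S ⊆ A ∪ C → Tendsto h (𝓝[S] x) (𝓝 γ) →
      (∀ᶠ ε in 𝓝[>] (0 : ℝ), x + ε • z ∈ S) →
      Tendsto (fun ε : ℝ => (A ∪ C).indicator h (x + ε • z)) (𝓝[>] 0) (𝓝 γ) := by
    intro S γ z hS hγ hz
    refine (hγ.comp (tendsto_nhdsWithin_iff.2 ⟨htend z, hz⟩)).congr' ?_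
    filter_upwards [hz] with ε hε
    simp [Set.indicator_of_mem (hS hε)]
  refine tendsto_integral_filter_of_dominated_convergence (fun z => |K| * ‖Ψ z‖) ?_ ?_
    (hΨ.norm.const_mul _) ?_
  · refine Eventually.of_forall fun ε => ?_
    exact (hm.comp (by fun_prop : Measurable fun z : E3 => x + ε • z)).aestronglyMeasurable.inner
      hΨ.aestronglyMeasurable
  · refine Eventually.of_forall fun ε => Eventually.of_forall fun z => ?_
    refine (norm_inner_le_norm _ _).trans (mul_le_mul_of_nonneg_right ?_ (norm_nonneg _))
    by_cases hz : x + ε • z ∈ A ∪ C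
    · rw [Set.indicator_of_mem hz]
      exact (hK _ hz).trans (le_abs_self K)
    · rw [Set.indicator_of_notMem hz, norm_zero]
      exact abs_nonneg K
  · filter_upwards [hplane] with z hz
    rcases lt_or_gt_of_ne hz with hz | hz
    · rw [if_pos hz]
      exact (hlim A α z Set.subset_union_left tA (coneA z hz)).inner tendsto_const_nhds
    · rw [if_neg hz.not_gt]
      exact (hlim C β z Set.subset_union_right tC (coneC z hz)).inner tendsto_const_nhds

theorem integral_comp_add_smul (G : E3 → ℝ) (x : E3) {ε : ℝ} (hε : 0 < ε) :
    ∫ y, G y = ε ^ 3 * ∫ z, G (x + ε • z) := by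
  rw [Measure.integral_comp_smul volume (fun y => G (x + y)) ε, integral_add_left_eq_self,
    finrank_euclideanSpace, Fintype.card_fin, abs_of_pos (by positivity), smul_eq_mul,
    mul_inv_cancel_left₀ (by positivity)]

-- Near `x` the function `f` strictly increases along `ν`, so translating its zero set by different
-- multiples of `ν` gives disjoint sets. Infinitely many of these fit in a bounded region, which
-- forces measure zero.
open scoped Pointwise in
theorem exists_nhds_volume_inter_zero_eq_zero {f : E3 → ℝ} {U : Set E3} {x ν : E3}
    (hU : IsOpen U) (hx : x ∈ U) (hf : ContDiffOn ℝ 1 f U) (hg : HasGradientAt f ν x)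
    (hν : ‖ν‖ = 1) : ∃ W ∈ 𝓝 x, W ⊆ U ∧ volume (W ∩ {y | f y = 0}) = 0 := by
  have hc : ContinuousOn (fun y => fderiv ℝ f y ν) U :=
    (hf.continuousOn_fderiv_of_isOpen hU le_rfl).clm_apply continuousOn_const
  have hpos : 0 < fderiv ℝ f x ν := by
    rw [hg.hasFDerivAt.fderiv]
    simp [hν]
  have hev : ∀ᶠ y in 𝓝 x, y ∈ U ∧ 0 < fderiv ℝ f y ν :=
    (hU.eventually_mem hx).and
      ((hc.continuousAt (hU.mem_nhds hx)).eventually (eventually_gt_nhds hpos))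
  obtain ⟨r, hr, hball⟩ := Metric.nhds_basis_closedBall.eventually_iff.1 hev
  set W := Metric.closedBall x r with hW
  have hWU : W ⊆ U := fun y hy => (hball hy).1
  have hmono : ∀ (y : E3) (c : ℝ), 0 < c → y ∈ W → y + c • ν ∈ W → f y < f (y + c • ν) := by
    intro y c hc0 hy hyc
    have hseg : ∀ t ∈ Set.Icc 0 c, y + t • ν ∈ W := fun t ht => by
      have hcv := (convex_closedBall x r) hy hyc (a := 1 - t / c) (b := t / c)
        (by rw [sub_nonneg, div_le_one hc0]; exact ht.2) (div_nonneg ht.1 hc0.le) (by ring)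
      convert hcv using 1
      rw [smul_add, smul_smul, div_mul_cancel₀ _ hc0.ne']
      module
    have hd : ∀ t ∈ Set.Icc 0 c, HasDerivAt (fun t : ℝ => f (y + t • ν))
        (fderiv ℝ f (y + t • ν) ν) t := fun t ht => by
      have h1 := ((hf.differentiableOn one_ne_zero).differentiableAt
        (hU.mem_nhds (hWU (hseg t ht)))).hasFDerivAt
      have h2 : HasDerivAt (fun t : ℝ => y + t • ν) ν t := by
        simpa using ((hasDerivAt_id t).smul_const ν).const_add y
      exact h1.comp_hasDerivAt t h2
    have hs : StrictMonoOn (fun t : ℝ => f (y + t • ν)) (Set.Icc 0 c) := by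
      refine strictMonoOn_of_deriv_pos (convex_Icc 0 c)
        (fun t ht => (hd t ht).continuousAt.continuousWithinAt) fun t ht => ?_
      rw [interior_Icc] at ht
      have ht' := Set.Ioo_subset_Icc_self ht
      rw [(hd t ht').deriv]
      exact (hball (hseg t ht')).2
    simpa using hs (Set.left_mem_Icc.2 hc0.le) (Set.right_mem_Icc.2 hc0.le) hc0
  refine ⟨W, Metric.closedBall_mem_nhds x hr, hWU, ?_⟩
  have hcl : IsClosed (W ∩ {y | f y = 0}) :=
    (hf.continuousOn.mono hWU).preimage_isClosed_of_isClosed Metric.isClosed_closedBall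
      isClosed_singleton
  refine Measure.addHaar_eq_zero_of_disjoint_translates volume
    (fun n : ℕ => (1 / ((n : ℝ) + 1)) • ν) ?_ ?_ hcl.measurableSet
  · refine (Metric.isBounded_closedBall (x := (0 : E3)) (r := 1)).subset ?_
    rintro _ ⟨n, rfl⟩
    rw [mem_closedBall_zero_iff, norm_smul, hν, mul_one, Real.norm_of_nonneg (by positivity)]
    rw [div_le_one (by positivity)]
    linarith [(Nat.cast_nonneg n : (0 : ℝ) ≤ n)]
  · have hlt : ∀ i j : ℕ, i < j → 
        Disjoint (({(1 / ((i : ℝ) + 1)) • ν} : Set E3) + W ∩ {y | f y = 0})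
          (({(1 / ((j : ℝ) + 1)) • ν} : Set E3) + W ∩ {y | f y = 0}) := by
      intro i j hij
      rw [Set.disjoint_left]
      simp only [Set.singleton_add, Set.mem_image, not_exists, not_and]
      rintro _ ⟨y, hy, rfl⟩ z hz hzy
      have hc0 : 0 < 1 / ((i : ℝ) + 1) - 1 / ((j : ℝ) + 1) := by
        rw [sub_pos]
        have : (i : ℝ) < j := by exact_mod_cast hij
        gcongr
      have hzy' : z = y + (1 / ((i : ℝ) + 1) - 1 / ((j : ℝ) + 1)) • ν := by
        rw [sub_smul, ← add_sub_assoc, add_comm y, ← hzy, add_sub_cancel_left]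
      have h1 := hmono y _ hc0 hy.1 (hzy' ▸ hz.1)
      rw [← hzy', show f y = 0 from hy.2, show f z = 0 from hz.2] at h1
      exact lt_irrefl _ h1
    intro i j hij
    rcases lt_or_gt_of_ne hij with h | h
    · exact hlt i j h
    · exact (hlt j i h).symm

section interface

variable {M : ℕ} {P : Fin M → Set E3} {m n : Fin M} {x ν : E3}

theorem IsInterfaceNormal.ne_zero (h : IsInterfaceNormal P m n x ν) : ν ≠ 0 := by
  rintro rfl
  simpa using h.1

theorem IsInterfaceNormal.symm (h : IsInterfaceNormal P m n x ν) :
    IsInterfaceNormal P n m x (-ν) := by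
  obtain ⟨hν, U, f, hU, hx, hf, hfx, hg, h1, h2⟩ := h
  refine ⟨by rwa [norm_neg], U, fun y => -f y, hU, hx, hf.neg, by simp [hfx], ?_, ?_, ?_⟩
  · rw [hasGradientAt_iff_hasFDerivAt] at hg ⊢
    rw [map_neg]
    exact hg.neg
  · simpa using h2
  · simpa using h1

theorem IsInterfaceNormal.eventually_mem_left (h : IsInterfaceNormal P m n x ν) {z : E3}
    (hz : inner ℝ ν z < 0) : ∀ᶠ ε in 𝓝[>] (0 : ℝ), x + ε • z ∈ P m := by
  obtain ⟨hν, U, f, hU, hx, hf, hfx, hg, h1, h2⟩ := h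
  have hc : Continuous fun ε : ℝ => x + ε • z := by fun_prop
  have hmem : ∀ᶠ ε in 𝓝[>] (0 : ℝ), x + ε • z ∈ U :=
    nhdsWithin_le_nhds (hc.continuousAt.eventually_mem (hU.mem_nhds (by simpa using hx)))
  have hd : HasDerivAt (fun ε : ℝ => f (x + ε • z)) (inner ℝ ν z) 0 := by
    have e1 : HasDerivAt (fun ε : ℝ => x + ε • z) z 0 := by
      simpa using ((hasDerivAt_id (0 : ℝ)).smul_const z).const_add x
    have e2 : HasFDerivAt f (InnerProductSpace.toDual ℝ E3 ν) (x + (0 : ℝ) • z) := by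
      simpa using hg.hasFDerivAt
    exact e2.comp_hasDerivAt (0 : ℝ) e1
  have hneg : ∀ᶠ ε in 𝓝[>] (0 : ℝ), f (x + ε • z) < 0 := by
    have hs := (hasDerivAt_iff_tendsto_slope.1 hd).mono_left
      (nhdsWithin_mono 0 fun t (ht : (0 : ℝ) < t) => ht.ne')
    filter_upwards [hs.eventually (eventually_lt_nhds hz), self_mem_nhdsWithin] with ε he hε
    have hε' : (0 : ℝ) < ε := hε
    simp only [slope, vsub_eq_sub, sub_zero, zero_smul, add_zero, hfx, smul_eq_mul] at he
    by_contra! hge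
    exact absurd he (not_lt.2 (by positivity))
  filter_upwards [hmem, hneg] with ε e1 e2
  have : x + ε • z ∈ P m ∩ U := h1 ▸ ⟨e2, e1⟩
  exact this.1

theorem IsInterfaceNormal.eventually_mem_right (h : IsInterfaceNormal P m n x ν) {z : E3}
    (hz : 0 < inner ℝ ν z) : ∀ᶠ ε in 𝓝[>] (0 : ℝ), x + ε • z ∈ P n :=
  h.symm.eventually_mem_left (by simpa using hz)

theorem IsInterfaceNormal.mem_closure_left (h : IsInterfaceNormal P m n x ν) :
    x ∈ closure (P m) := by
  have hz : inner ℝ ν (-ν) < 0 := by simp [h.1]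
  have hc : Continuous fun ε : ℝ => x + ε • (-ν) := by fun_prop
  refine mem_closure_of_tendsto ?_ (h.eventually_mem_left hz)
  simpa using (hc.tendsto 0).mono_left nhdsWithin_le_nhds

theorem IsInterfaceNormal.mem_closure_right (h : IsInterfaceNormal P m n x ν) :
    x ∈ closure (P n) := h.symm.mem_closure_left

theorem IsInterfaceNormal.ne (h : IsInterfaceNormal P m n x ν) : m ≠ n := by
  rintro rfl
  obtain ⟨hν, U, f, hU, hx, hf, hfx, hg, h1, h2⟩ := id h
  obtain ⟨y, hyU, hyP⟩ := mem_closure_iff.1 h.mem_closure_left U hU hx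
  have e1 : y ∈ {y | f y < 0} ∩ U := h1 ▸ ⟨hyP, hyU⟩
  have e2 : y ∈ {y | 0 < f y} ∩ U := h2 ▸ ⟨hyP, hyU⟩
  exact lt_asymm (show f y < 0 from e1.1) e2.1

theorem IsInterfaceNormal.exists_nhds_ae_mem (h : IsInterfaceNormal P m n x ν) :
    ∃ W ∈ 𝓝 x, ∀ᵐ y, y ∈ W → y ∈ P m ∪ P n := by
  obtain ⟨hν, U, f, hU, hx, hf, hfx, hg, h1, h2⟩ := h
  obtain ⟨W, hW, hWU, hnull⟩ := exists_nhds_volume_inter_zero_eq_zero hU hx hf hg hν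
  refine ⟨W, hW, ?_⟩
  filter_upwards [measure_eq_zero_iff_ae_notMem.1 hnull] with y hy hyW
  rcases lt_trichotomy (f y) 0 with h | h | h
  · have : y ∈ P m ∩ U := h1 ▸ ⟨h, hWU hyW⟩
    exact Or.inl this.1
  · exact absurd ⟨hyW, h⟩ hy
  · have : y ∈ P n ∩ U := h2 ▸ ⟨h, hWU hyW⟩
    exact Or.inr this.1

end interface

theorem continuous_gradient {φ : E3 → ℝ} (h : ContDiff ℝ 1 φ) : Continuous (∇ φ) :=
  (InnerProductSpace.toDual ℝ E3).symm.continuous.comp (h.continuous_fderiv one_ne_zero)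

theorem continuousOn_gradient {φ : E3 → ℝ} {V : Set E3} (hV : IsOpen V) (h : ContDiffOn ℝ 1 φ V) :
    ContinuousOn (∇ φ) V :=
  (InnerProductSpace.toDual ℝ E3).symm.continuous.comp_continuousOn
    (h.continuousOn_fderiv_of_isOpen hV le_rfl)

/-- The integral of `∂_q φ` over the whole space vanishes. Subtracting it leaves the integral of
`∂_{p-q} φ` over a half-space, which is not always zero if `p - q` has a normal component. -/
theorem inner_sub_eq_zero_of_integral_gradient {ν p q : E3} (hν : ‖ν‖ = 1)
    (h : ∀ φ, IsTestFunction Set.univ φ →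
      ∫ z, inner ℝ (if inner ℝ ν z < 0 then p else q) (∇ φ z) = 0) : inner ℝ ν (p - q) = 0 := by
  by_contra hne
  obtain ⟨φ, h1, h2, h3⟩ := exists_integral_halfSpace_fderiv_ne_zero hν hne
  have hφ : IsTestFunction Set.univ φ := ⟨h1, h2, Set.subset_univ _⟩
  have hAm : MeasurableSet {z : E3 | inner ℝ ν z < 0} :=
    (isOpen_lt (by fun_prop) continuous_const).measurableSet
  have e0 : ∫ z, fderiv ℝ φ z q = 0 := by
    simpa using hφ.integral_mul_fderiv isOpen_univ (contDiffOn_const (c := (1 : ℝ))) q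
  have i1 : ∀ v, Integrable fun z => fderiv ℝ φ z v := fun v =>
    (hφ.fderiv_apply v).continuous.integrable_of_hasCompactSupport (hφ.fderiv_apply v).2.1
  refine h3 ?_
  have e1 := integral_add ((i1 (p - q)).indicator hAm) (i1 q)
  rw [e0, add_zero, integral_indicator hAm] at e1
  refine e1.symm.trans (Eq.trans (integral_congr_ae (Eventually.of_forall fun z => ?_)) (h φ hφ))
  have hc : ∀ v, inner ℝ v (∇ φ z) = fderiv ℝ φ z v := fun v => by
    rw [real_inner_comm, inner_gradient_left]
  by_cases hz : inner ℝ ν z < 0 <;> simp [hz, hc]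

theorem IsTestFunction.comp_smul_sub {φ : E3 → ℝ} (hφ : IsTestFunction Set.univ φ) (x : E3)
    {r : ℝ} (hr : 0 < r) : ∀ᶠ ε in 𝓝[>] (0 : ℝ),
      IsTestFunction (Metric.ball x r) fun y => φ (ε⁻¹ • (y - x)) := by
  obtain ⟨ρ, hρ⟩ := (hφ.2.1.isBounded.subset_closedBall (0 : E3))
  have hρ' : ∀ z, φ z ≠ 0 → ‖z‖ ≤ |ρ| := fun z hz =>
    (mem_closedBall_zero_iff.1 (hρ (subset_tsupport φ hz))).trans (le_abs_self ρ)
  have hsmall : ∀ᶠ ε in 𝓝[>] (0 : ℝ), ε * |ρ| < r := by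
    have hc : Continuous fun ε : ℝ => ε * |ρ| := by fun_prop
    exact nhdsWithin_le_nhds (hc.continuousAt.eventually (eventually_lt_nhds (by simpa using hr)))
  filter_upwards [hsmall, self_mem_nhdsWithin] with ε h1 hε
  have hε : 0 < ε := hε
  have hcd : ContDiff ℝ ∞ fun y => φ (ε⁻¹ • (y - x)) :=
    hφ.1.comp (by fun_prop)
  have hsupp : Function.support (fun y => φ (ε⁻¹ • (y - x))) ⊆ Metric.closedBall x (ε * |ρ|) := by
    intro y hy
    have := hρ' _ hy
    rw [norm_smul, norm_inv, Real.norm_of_nonneg hε.le, inv_mul_le_iff₀ hε] at this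
    rwa [Metric.mem_closedBall, dist_eq_norm]
  exact ⟨hcd, HasCompactSupport.of_support_subset_isCompact (isCompact_closedBall _ _) hsupp,
    (closure_minimal hsupp Metric.isClosed_closedBall).trans
      (Metric.closedBall_subset_ball h1)⟩

theorem gradient_comp_smul_sub {φ : E3 → ℝ} (hφ : ContDiff ℝ ∞ φ) (x y : E3) (ε : ℝ) :
    ∇ (fun y => φ (ε⁻¹ • (y - x))) y = ε⁻¹ • ∇ φ (ε⁻¹ • (y - x)) := by
  refine HasGradientAt.gradient ?_
  rw [hasGradientAt_iff_hasFDerivAt]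
  have h1 : HasFDerivAt (fun y : E3 => ε⁻¹ • (y - x)) (ε⁻¹ • ContinuousLinearMap.id ℝ E3) y :=
    ((hasFDerivAt_id y).sub_const x).const_smul ε⁻¹
  have h2 := ((hφ.differentiable (by simp)).differentiableAt
    (x := ε⁻¹ • (y - x))).hasFDerivAt.comp y h1
  refine h2.congr_fderiv ?_
  ext v
  simp [gradient]

section interface

variable {M : ℕ} {P : Fin M → Set E3} {m n : Fin M} {x ν : E3}

/-- A bounded piecewise continuous field `h₁` with `div h₁ = h₀` bounded near an interface point
has continuous normal component there. -/
theorem IsInterfaceNormal.inner_jump_eq_zero (hI : IsInterfaceNormal P m n x ν)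
    (hm : IsOpen (P m)) (hn : IsOpen (P n)) {h₁ : E3 → E3} {h₀ : E3 → ℝ} {p q : E3} {p₀ q₀ r : ℝ}
    (hr : 0 < r) (c1m : ContinuousOn h₁ (P m)) (c1n : ContinuousOn h₁ (P n))
    (c0m : ContinuousOn h₀ (P m)) (c0n : ContinuousOn h₀ (P n))
    (t1m : Tendsto h₁ (𝓝[P m] x) (𝓝 p)) (t1n : Tendsto h₁ (𝓝[P n] x) (𝓝 q))
    (t0m : Tendsto h₀ (𝓝[P m] x) (𝓝 p₀)) (t0n : Tendsto h₀ (𝓝[P n] x) (𝓝 q₀))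
    (heq : ∀ φ, IsTestFunction (Metric.ball x r) φ →
      ∫ y, (inner ℝ ((P m ∪ P n).indicator h₁ y) (∇ φ y)
        + (P m ∪ P n).indicator h₀ y * φ y) = 0) :
    inner ℝ ν (p - q) = 0 := by
  classical
  obtain ⟨K, hK⟩ : ∃ K : ℝ, ∀ᶠ y in 𝓝 x, y ∈ P m ∪ P n → ‖h₁ y‖ ≤ K ∧ ‖h₀ y‖ ≤ K := by
    refine ⟨max (max (‖p‖ + 1) (‖q‖ + 1)) (max (‖p₀‖ + 1) (‖q₀‖ + 1)), ?_⟩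
    have b1 := t1m.norm.eventually (eventually_lt_nhds (lt_add_one ‖p‖))
    have b2 := t1n.norm.eventually (eventually_lt_nhds (lt_add_one ‖q‖))
    have b3 := t0m.norm.eventually (eventually_lt_nhds (lt_add_one ‖p₀‖))
    have b4 := t0n.norm.eventually (eventually_lt_nhds (lt_add_one ‖q₀‖))
    rw [eventually_nhdsWithin_iff] at b1 b2 b3 b4
    filter_upwards [b1, b2, b3, b4] with y h1 h2 h3 h4
    rintro (hy | hy)
    · exact ⟨(h1 hy).le.trans (by simp), (h3 hy).le.trans (by simp)⟩
    · exact ⟨(h2 hy).le.trans (by simp), (h4 hy).le.trans (by simp)⟩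
  obtain ⟨s, hs, hsK⟩ := Metric.nhds_basis_ball.eventually_iff.1 hK
  set B := Metric.ball x (min r s) with hB
  have hrs : 0 < min r s := lt_min hr hs
  have hBx : B ∈ 𝓝 x := Metric.ball_mem_nhds x hrs
  have hAo : IsOpen (P m ∩ B) := hm.inter Metric.isOpen_ball
  have hCo : IsOpen (P n ∩ B) := hn.inter Metric.isOpen_ball
  have hcone : ∀ z : E3, ∀ᶠ ε in 𝓝[>] (0 : ℝ), x + ε • z ∈ B := fun z => by
    have hc : Continuous fun ε : ℝ => x + ε • z := by fun_prop
    exact nhdsWithin_le_nhds (hc.continuousAt.eventually_mem (by simpa using hBx))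
  have coneA : ∀ z, inner ℝ ν z < 0 → ∀ᶠ ε in 𝓝[>] (0 : ℝ), x + ε • z ∈ P m ∩ B :=
    fun z hz => (hI.eventually_mem_left hz).and (hcone z)
  have coneC : ∀ z, 0 < inner ℝ ν z → ∀ᶠ ε in 𝓝[>] (0 : ℝ), x + ε • z ∈ P n ∩ B :=
    fun z hz => (hI.eventually_mem_right hz).and (hcone z)
  have hbd : ∀ y ∈ P m ∩ B ∪ P n ∩ B, ‖h₁ y‖ ≤ K ∧ ‖h₀ y‖ ≤ K := by
    rintro y (hy | hy)
    · exact hsK (Metric.ball_subset_ball (min_le_right r s) hy.2) (Or.inl hy.1)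
    · exact hsK (Metric.ball_subset_ball (min_le_right r s) hy.2) (Or.inr hy.1)
  refine inner_sub_eq_zero_of_integral_gradient hI.1 fun φ hφ => ?_
  have hφ1 : ContDiff ℝ 1 φ := contDiff_infty.1 hφ.1 1
  have hgi : Integrable (∇ φ) := by
    refine (continuous_gradient hφ1).integrable_of_hasCompactSupport ?_
    exact (hφ.2.1.fderiv (𝕜 := ℝ)).comp_left (g := (InnerProductSpace.toDual ℝ E3).symm)
      (map_zero _)
  have hφi : Integrable φ := hφ.continuous.integrable_of_hasCompactSupport hφ.2.1
  have l1 := tendsto_integral_inner_blowup hAo hCo (c1m.mono Set.inter_subset_left)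
    (c1n.mono Set.inter_subset_left) (fun y hy => (hbd y hy).1)
    (t1m.mono_left (nhdsWithin_mono x Set.inter_subset_left))
    (t1n.mono_left (nhdsWithin_mono x Set.inter_subset_left)) hI.ne_zero coneA coneC hgi
  have l0 := tendsto_integral_inner_blowup hAo hCo (c0m.mono Set.inter_subset_left)
    (c0n.mono Set.inter_subset_left) (fun y hy => (hbd y hy).2)
    (t0m.mono_left (nhdsWithin_mono x Set.inter_subset_left))
    (t0n.mono_left (nhdsWithin_mono x Set.inter_subset_left)) hI.ne_zero coneA coneC hφi
  set S := P m ∩ B ∪ P n ∩ B with hS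
  -- For `φ((y - x)/ε)` the gradient term is larger by a factor `ε⁻¹` than the zeroth-order term, so
  -- the rescaled equation says that the first integral is `-ε` times the second, which stays
  -- bounded.
  have hε0 : Tendsto (fun ε : ℝ => -ε) (𝓝[>] 0) (𝓝 0) := by
    simpa using (tendsto_id.neg : Tendsto (fun ε : ℝ => -ε) (𝓝 0) _).mono_left nhdsWithin_le_nhds
  have l0' := hε0.mul l0
  rw [zero_mul] at l0'
  refine tendsto_nhds_unique (l1.congr' ?_) l0'
  filter_upwards [hφ.comp_smul_sub x hrs, self_mem_nhdsWithin] with ε ht hε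
  have hε : 0 < ε := hε
  have e1 := heq _ (ht.mono (Metric.ball_subset_ball (min_le_left r s)))
  have e2 : ∫ y, (inner ℝ (S.indicator h₁ y) (∇ (fun y => φ (ε⁻¹ • (y - x))) y)
      + S.indicator h₀ y * φ (ε⁻¹ • (y - x))) = 0 := by
    rw [← e1]
    refine integral_congr_ae (Eventually.of_forall fun y => ?_)
    by_cases hy : y ∈ B
    · have : y ∈ S ↔ y ∈ P m ∪ P n := by simp [hS, hy]
      have hind : ∀ {F : Type} [Zero F] (h : E3 → F),
          S.indicator h y = (P m ∪ P n).indicator h y := fun h => by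
        by_cases hy' : y ∈ P m ∪ P n
        · rw [Set.indicator_of_mem (this.2 hy'), Set.indicator_of_mem hy']
        · rw [Set.indicator_of_notMem (mt this.1 hy'), Set.indicator_of_notMem hy']
      simp only [hind]
    · have h1 : φ (ε⁻¹ • (y - x)) = 0 := ht.eq_zero hy
      simp [h1, ht.gradient_eq_zero hy]
  rw [integral_comp_add_smul _ x hε] at e2
  have e3 := (mul_eq_zero.1 e2).resolve_left (by positivity)
  have hsc : ∀ z : E3, ε⁻¹ • (x + ε • z - x) = z := fun z => by
    rw [add_sub_cancel_left, inv_smul_smul₀ hε.ne']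
  simp only [gradient_comp_smul_sub hφ.1, hsc, inner_smul_right] at e3
  have hmeas : ∀ {F : Type} [NormedAddCommGroup F] [MeasurableSpace F] [BorelSpace F]
      (h : E3 → F), ContinuousOn h (P m) → ContinuousOn h (P n) →
      Measurable fun z : E3 => S.indicator h (x + ε • z) := by
    intro F _ _ _ h hhm hhn
    have : Measurable (S.indicator h) := by
      rw [← Set.piecewise_eq_indicator]
      exact ((hhm.mono Set.inter_subset_left).union_of_isOpen
        (hhn.mono Set.inter_subset_left) hAo hCo).measurable_piecewise continuousOn_const
        (hAo.union hCo).measurableSet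
    exact this.comp (by fun_prop)
  have hK0 : ∀ y, ‖S.indicator h₁ y‖ ≤ |K| ∧ ‖S.indicator h₀ y‖ ≤ |K| := fun y => by
    by_cases hy : y ∈ S
    · rw [Set.indicator_of_mem hy, Set.indicator_of_mem hy]
      exact ⟨(hbd y hy).1.trans (le_abs_self K), (hbd y hy).2.trans (le_abs_self K)⟩
    · simp [Set.indicator_of_notMem hy]
  have i1 : Integrable fun z => inner ℝ (S.indicator h₁ (x + ε • z)) (∇ φ z) := by
    refine (hgi.norm.const_mul |K|).mono'
      ((hmeas h₁ c1m c1n).aestronglyMeasurable.inner hgi.aestronglyMeasurable)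
      (Eventually.of_forall fun z => ?_)
    exact (norm_inner_le_norm _ _).trans
      (mul_le_mul_of_nonneg_right (hK0 _).1 (norm_nonneg _))
  have i0 : Integrable fun z => S.indicator h₀ (x + ε • z) * φ z := by
    refine (hφi.norm.const_mul |K|).mono'
      ((hmeas h₀ c0m c0n).aestronglyMeasurable.mul hφi.aestronglyMeasurable)
      (Eventually.of_forall fun z => ?_)
    rw [norm_mul]
    exact mul_le_mul_of_nonneg_right (hK0 _).2 (norm_nonneg _)
  rw [integral_add (i1.const_mul _) i0, integral_const_mul] at e3
  have e4 : ∫ z, inner ℝ (S.indicator h₀ (x + ε • z)) (φ z)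
      = ∫ z, S.indicator h₀ (x + ε • z) * φ z := by
    simp [mul_comm]
  rw [e4]
  field_simp at e3
  linarith

end interface

/-! ### Sets of zero surface measure do not separate -/

section nullSets

theorem volume_eq_zero_of_hausdorffMeasure_two {E : Set E3}
    (hE : Measure.hausdorffMeasure 2 E = 0) : volume E = 0 := by
  have h3 : Measure.hausdorffMeasure 3 E = 0 := by
    rcases Measure.hausdorffMeasure_zero_or_top (show (2 : ℝ) < 3 by norm_num) E with h | h
    · exact h
    · rw [hE] at h
      exact absurd h ENNReal.zero_ne_top
  have hfin : ((Module.finrank ℝ E3 : ℕ) : ℝ) = 3 := by simp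
  have : (Measure.hausdorffMeasure 3 : Measure E3).IsAddHaarMeasure := hfin ▸ inferInstance
  exact Measure.absolutelyContinuous_isAddHaarMeasure volume (Measure.hausdorffMeasure 3) h3

theorem exists_linearMap_fin_two {e : E3} (he : e ≠ 0) :
    ∃ L : E3 →L[ℝ] (Fin 2 → ℝ), Function.Surjective L ∧ L e = 0 := by
  have hd : Module.finrank ℝ (E3 ⧸ (ℝ ∙ e)) = Module.finrank ℝ (Fin 2 → ℝ) := by
    have h1 := Submodule.finrank_quotient_add_finrank (ℝ ∙ e)
    rw [finrank_span_singleton he] at h1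
    simp only [finrank_euclideanSpace, Fintype.card_fin] at h1
    simp only [Module.finrank_fin_fun]
    omega
  let T := (LinearEquiv.ofFinrankEq _ _ hd).toLinearMap ∘ₗ (ℝ ∙ e).mkQ
  refine ⟨LinearMap.toContinuousLinearMap T, ?_, ?_⟩
  · exact (LinearEquiv.surjective _).comp (Submodule.mkQ_surjective _)
  · simp [T, Submodule.mem_span_singleton_self]

/-- Projection along `e` onto a plane is Lipschitz, so it sends `E` to a Lebesgue null set, while it
sends `N` to a nonempty open set. A point of the second image outside the first gives a line that
misses `E`. -/
theorem exists_forall_add_smul_notMem {E N : Set E3} (hE : Measure.hausdorffMeasure 2 E = 0)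
    (hN : IsOpen N) (hne : N.Nonempty) {e : E3} (he : e ≠ 0) :
    ∃ z ∈ N, ∀ t : ℝ, z + t • e ∉ E := by
  obtain ⟨L, hLs, hLe⟩ := exists_linearMap_fin_two he
  have hLE : volume (L '' E) = 0 := by
    have h := L.lipschitz.hausdorffMeasure_image_le (show (0 : ℝ) ≤ 2 by norm_num) E
    rw [hE, mul_zero, nonpos_iff_eq_zero] at h
    rw [← hausdorffMeasure_pi_real]
    simpa using h
  have hLN : 0 < volume (L '' N) :=
    ((L.isOpenMap hLs) N hN).measure_pos volume (hne.image L)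
  obtain ⟨_, ⟨z, hz, rfl⟩, hzE⟩ : ∃ w ∈ L '' N, w ∉ L '' E := by
    by_contra! h
    exact hLN.ne' (measure_mono_null h hLE)
  refine ⟨z, hz, fun t ht => hzE ⟨_, ht, ?_⟩⟩
  simp [hLe]

/-- A set of zero `2`-dimensional Hausdorff measure does not separate a convex open set: a function
that is locally almost everywhere constant off such a set is almost everywhere constant. -/
theorem exists_ae_eq_const {α : Type*} {F : E3 → α} {B E : Set E3} (hB : IsOpen B)
    (hconv : Convex ℝ B) (hne : B.Nonempty) (hE : Measure.hausdorffMeasure 2 E = 0)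
    (hloc : ∀ y ∈ B, y ∉ E → ∃ V ∈ 𝓝 y, ∃ a, ∀ᵐ z, z ∈ V → F z = a) :
    ∃ a, ∀ᵐ z, z ∈ B → F z = a := by
  have hE0 := volume_eq_zero_of_hausdorffMeasure_two hE
  let G : α → Set E3 := fun a => {y | ∃ V ∈ 𝓝 y, ∀ᵐ z, z ∈ V → F z = a}
  have hG : ∀ a, IsOpen (G a) := by
    intro a
    rw [isOpen_iff_mem_nhds]
    rintro y ⟨V, hV, h⟩
    obtain ⟨O, hOV, hO, hyO⟩ := mem_nhds_iff.1 hV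
    filter_upwards [hO.mem_nhds hyO] with z hz
    exact ⟨V, mem_of_superset (hO.mem_nhds hz) hOV, h⟩
  have huniq : ∀ a b y, y ∈ G a → y ∈ G b → a = b := by
    rintro a b y ⟨V, hV, h1⟩ ⟨W, hW, h2⟩
    have hpos : 0 < volume (V ∩ W) := Measure.measure_pos_of_mem_nhds volume (inter_mem hV hW)
    by_contra hab
    refine hpos.ne' (measure_mono_null ?_ (h1.and h2))
    intro z hz hz'
    exact hab ((hz'.1 hz.1).symm.trans (hz'.2 hz.2))
  obtain ⟨p, hpB, hpE⟩ : ∃ p ∈ B, p ∉ E := by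
    by_contra! h
    exact (hB.measure_pos volume hne).ne' (measure_mono_null h hE0)
  obtain ⟨V, hV, a, ha⟩ := hloc p hpB hpE
  have hpa : p ∈ G a := ⟨V, hV, ha⟩
  have hall : ∀ q ∈ B, q ∉ E → q ∈ G a := by
    intro q hqB hqE
    obtain ⟨V', hV', b, hb⟩ := hloc q hqB hqE
    have hqb : q ∈ G b := ⟨V', hV', hb⟩
    rcases eq_or_ne q p with rfl | hqp
    · exact hpa
    -- These are the starting points near `p` whose translate by `q - p` lands near `q`. One of them
    -- spans a segment missing `E`; its points are covered by the disjoint open sets `G c`, so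
    -- connectedness forces the same constant at both ends.
    have hN : IsOpen ((G a ∩ B) ∩ (fun z => z + (q - p)) ⁻¹' (G b ∩ B)) :=
      ((hG a).inter hB).inter (((hG b).inter hB).preimage (by fun_prop))
    obtain ⟨z, ⟨hz1, hz2⟩, hz3⟩ := exists_forall_add_smul_notMem hE hN
      ⟨p, ⟨hpa, hpB⟩, by simpa using ⟨hqb, hqB⟩⟩ (sub_ne_zero.2 hqp)
    have hseg : segment ℝ z (z + (q - p)) ⊆ G a ∪ ⋃ c ∈ {c | c ≠ a}, G c := by
      intro y hy
      have hyB : y ∈ B := hconv.segment_subset hz1.2 hz2.2 hy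
      rw [segment_eq_image'] at hy
      obtain ⟨t, -, rfl⟩ := hy
      rw [add_sub_cancel_left] at hyB ⊢
      obtain ⟨V'', hV'', c, hc⟩ := hloc _ hyB (hz3 t)
      rcases eq_or_ne c a with rfl | hca
      · exact Or.inl ⟨V'', hV'', hc⟩
      · exact Or.inr (Set.mem_biUnion hca ⟨V'', hV'', hc⟩)
    have hdisj : Disjoint (G a) (⋃ c ∈ {c | c ≠ a}, G c) := by
      rw [Set.disjoint_left]
      intro y hy hy'
      obtain ⟨c, hca, hyc⟩ := Set.mem_iUnion₂.1 hy'
      exact hca (huniq c a y hyc hy)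
    have := (convex_segment z (z + (q - p))).isPreconnected.subset_left_of_subset_union (hG a)
      (isOpen_biUnion fun c _ => hG c) hdisj hseg ⟨z, left_mem_segment ℝ _ _, hz1.1⟩
    have hab := huniq a b _ (this (right_mem_segment ℝ _ _)) hz2.1
    exact hab ▸ hqb
  refine ⟨a, ?_⟩
  have hnull : volume {z | z ∈ B ∧ z ∉ E ∧ F z ≠ a} = 0 := by
    refine measure_null_of_locally_null _ fun y hy => ?_
    obtain ⟨V', hV', hb⟩ := hall y hy.1 hy.2.1
    refine ⟨{z | z ∈ B ∧ z ∉ E ∧ F z ≠ a} ∩ V', inter_mem_nhdsWithin _ hV', ?_⟩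
    refine measure_mono_null ?_ hb
    intro z hz hz'
    exact hz.1.2.2 (hz' hz.2)
  filter_upwards [measure_eq_zero_iff_ae_notMem.1 hnull, measure_eq_zero_iff_ae_notMem.1 hE0]
    with z h1 h2 hzB
  by_contra hne'
  exact h1 ⟨hzB, h2, hne'⟩

end nullSets

/-! ### Almost everywhere representatives and jump sets -/

theorem setIntegral_eq_integral_of_ae_eq {Ω B : Set E3} {G G' : E3 → ℝ} (hB : B ⊆ Ω)
    (h : ∀ᵐ y, y ∈ B → G y = G' y) (hG : ∀ y ∉ B, G y = 0) (hG' : ∀ y ∉ B, G' y = 0) :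
    ∫ y in Ω, G y = ∫ y, G' y := by
  rw [setIntegral_eq_integral_of_forall_compl_eq_zero fun y hy => hG y fun h => hy (hB h)]
  refine integral_congr_ae ?_
  filter_upwards [h] with y hy
  by_cases hyB : y ∈ B
  · exact hy hyB
  · rw [hG y hyB, hG' y hyB]

theorem eqOn_of_ae_eq {f g : E3 → ℝ} {B Q : Set E3} (hB : IsOpen B) (hQ : IsOpen Q)
    (hg : ContinuousOn g B) (hf : ContinuousOn f Q) (h : ∀ᵐ y, y ∈ B → f y = g y) :
    Set.EqOn f g (Q ∩ B) := by
  refine Measure.eqOn_open_of_ae_eq (μ := volume) ?_ (hQ.inter hB)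
    (hf.mono Set.inter_subset_left) (hg.mono Set.inter_subset_right)
  rw [EventuallyEq, ae_restrict_iff' (hQ.inter hB).measurableSet]
  filter_upwards [h] with y hy hyQ using hy hyQ.2

theorem eq_of_tendsto_of_ae_eq {f g : E3 → ℝ} {B Q : Set E3} {x : E3} {a : ℝ} (hB : IsOpen B)
    (hQ : IsOpen Q) (hx : x ∈ B) (hxQ : x ∈ closure Q) (hg : ContinuousOn g B)
    (hf : ContinuousOn f Q) (h : ∀ᵐ y, y ∈ B → f y = g y) (ht : Tendsto f (𝓝[Q] x) (𝓝 a)) :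
    g x = a := by
  have : (𝓝[Q] x).NeBot := mem_closure_iff_nhdsWithin_neBot.1 hxQ
  have h1 : Tendsto g (𝓝[Q] x) (𝓝 (g x)) :=
    (hg.continuousAt (hB.mem_nhds hx)).tendsto.mono_left nhdsWithin_le_nhds
  refine tendsto_nhds_unique (h1.congr' ?_) ht
  filter_upwards [self_mem_nhdsWithin, nhdsWithin_le_nhds (hB.mem_nhds hx)] with y h2 h3
  exact (eqOn_of_ae_eq hB hQ hg hf h ⟨h2, h3⟩).symm

theorem isCk_iff {k : ℕ} {f : E3 → ℝ} {B : Set E3} (hB : IsOpen B) :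
    IsCk k f B ↔ ∃ g : E3 → ℝ, ContDiffOn ℝ k g B ∧ ∀ᵐ y, y ∈ B → f y = g y := by
  simp only [IsCk, EventuallyEq, ae_restrict_iff' hB.measurableSet]

theorem notMem_jumpSet_iff {k : ℕ} {Ω : Set E3} {f : E3 → ℝ} {x : E3} (hx : x ∈ Ω) :
    x ∉ jumpSet k Ω f ↔ ∃ B ⊆ Ω, IsOpen B ∧ x ∈ B ∧
      ∃ g : E3 → ℝ, ContDiffOn ℝ k g B ∧ ∀ᵐ y, y ∈ B → f y = g y := by
  simp only [jumpSet, Set.mem_sdiff, hx, true_and, not_not, Set.mem_sUnion, Set.mem_ofPred_eq]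
  constructor
  · rintro ⟨B, ⟨h1, h2, h3⟩, h4⟩
    exact ⟨B, h1, h2, h4, (isCk_iff h2).1 h3⟩
  · rintro ⟨B, h1, h2, h4, h3⟩
    exact ⟨B, ⟨h1, h2, (isCk_iff h2).2 h3⟩, h4⟩

theorem measurableSet_jumpSet {k : ℕ} {Ω : Set E3} {f : E3 → ℝ} (hΩ : IsOpen Ω) :
    MeasurableSet (jumpSet k Ω f) :=
  hΩ.measurableSet.diff (isOpen_sUnion fun _ hB => hB.2.1).measurableSet

theorem notMem_jumpSet_of_ae_eq_const {k : ℕ} {Ω V : Set E3} {f : E3 → ℝ} {x : E3} {a : ℝ}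
    (hΩ : IsOpen Ω) (hx : x ∈ Ω) (hV : V ∈ 𝓝 x) (h : ∀ᵐ y, y ∈ V → f y = a) :
    x ∉ jumpSet k Ω f := by
  rw [notMem_jumpSet_iff hx]
  refine ⟨interior V ∩ Ω, Set.inter_subset_right, isOpen_interior.inter hΩ,
    ⟨mem_interior_iff_mem_nhds.2 hV, hx⟩, fun _ => a, contDiffOn_const, ?_⟩
  filter_upwards [h] with y hy hyV using hy (interior_subset hyV.1)

/-! ### Transmission conditions and jumps of the coefficients -/

section partition

variable {M : ℕ} {Ω : Set E3} {P : Fin M → Set E3} {μc Dc Γc : Fin M → ℝ} {u : E3 → ℝ}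

theorem IsPartition.piecewiseConst_eq (hP : IsPartition Ω P) (c : Fin M → ℝ) {m : Fin M} {x : E3}
    (hx : x ∈ P m) : piecewiseConst P c x = c m := by
  rw [piecewiseConst, Finset.sum_eq_single m, Set.indicator_of_mem hx]
  · intro k _ hk
    exact Set.indicator_of_notMem (fun h => (hP.disjoint k m hk).le_bot ⟨h, hx⟩) _
  · simp

theorem IsPartition.continuousOn_piecewiseConst (hP : IsPartition Ω P) (c : Fin M → ℝ)
    (m : Fin M) : ContinuousOn (piecewiseConst P c) (P m) :=
  continuousOn_const.congr fun _ hx => hP.piecewiseConst_eq c hx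

theorem IsPartition.tendsto_piecewiseConst (hP : IsPartition Ω P) (c : Fin M → ℝ) (m : Fin M)
    (x : E3) : Tendsto (piecewiseConst P c) (𝓝[P m] x) (𝓝 (c m)) :=
  tendsto_const_nhds.congr' <| by
    filter_upwards [self_mem_nhdsWithin] with y hy using (hP.piecewiseConst_eq c hy).symm

theorem IsPartition.exists_mem_closure (hP : IsPartition Ω P) {x : E3} (hx : x ∈ Ω) :
    ∃ m, x ∈ closure (P m) := by
  have := subset_closure hx
  rw [hP.closure_eq] at this
  exact Set.mem_iUnion.1 this

/-- Both conclusions are normal continuity of a field with bounded divergence. The definition of the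
weak gradient supplies the field `u ν` with divergence `∇u · ν`, and the diffusion equation supplies
`D ∇u` with divergence `μ u`. -/
theorem IsFluence.interface_conditions (hP : IsPartition Ω P)
    (hu : IsFluence Ω P (piecewiseConst P μc) (piecewiseConst P Dc) u) {m n : Fin M} {x ν : E3}
    (hx : x ∈ Ω) (hI : IsInterfaceNormal P m n x ν) {a a' : ℝ} {b b' : E3}
    (ta : Tendsto u (𝓝[P m] x) (𝓝 a)) (ta' : Tendsto u (𝓝[P n] x) (𝓝 a'))
    (tb : Tendsto (∇ u) (𝓝[P m] x) (𝓝 b)) (tb' : Tendsto (∇ u) (𝓝[P n] x) (𝓝 b')) :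
    a = a' ∧ inner ℝ ν (Dc m • b - Dc n • b') = 0 := by
  obtain ⟨huL, g, hgL, hg, hw⟩ := hu.weak
  have hm := hP.isOpen_part m
  have hn := hP.isOpen_part n
  have hum := hu.contDiffOn m
  have hun := hu.contDiffOn n
  have hgm := hg.ae_eq_gradient hgL hP.isOpen hm (hP.subset m) hum
  have hgn := hg.ae_eq_gradient hgL hP.isOpen hn (hP.subset n) hun
  obtain ⟨W, hW, hWae⟩ := hI.exists_nhds_ae_mem
  obtain ⟨r, hr, hball⟩ := Metric.mem_nhds_iff.1 (inter_mem hW (hP.isOpen.mem_nhds hx))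
  have hBΩ : Metric.ball x r ⊆ Ω := fun y hy => (hball hy).2
  have hae : ∀ᵐ y, y ∈ Metric.ball x r → y ∈ P m ∪ P n ∧ g y = ∇ u y := by
    filter_upwards [hgm, hgn, hWae] with y h1 h2 h3 hy
    have h4 := h3 (hball hy).1
    exact ⟨h4, h4.elim h1 h2⟩
  have cgm := continuousOn_gradient hm hum
  have cgn := continuousOn_gradient hn hun
  constructor
  · have key := hI.inner_jump_eq_zero hm hn (h₁ := fun y => u y • ν)
      (h₀ := fun y => inner ℝ (∇ u y) ν) hr (hum.continuousOn.smul continuousOn_const)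
      (hun.continuousOn.smul continuousOn_const) (cgm.inner continuousOn_const)
      (cgn.inner continuousOn_const) (ta.smul_const ν) (ta'.smul_const ν)
      (tb.inner tendsto_const_nhds) (tb'.inner tendsto_const_nhds) ?_
    · rw [← sub_smul, inner_smul_right, real_inner_self_eq_norm_sq, hI.1] at key
      linarith
    · intro φ hφ
      have hφΩ := hφ.mono hBΩ
      have e := hg φ hφΩ ν
      have i1 : Integrable (fun y => u y * inner ℝ (∇ φ y) ν) (volume.restrict Ω) := by
        simp only [inner_gradient_left]
        exact huL.integrable_mul_test (hφΩ.fderiv_apply ν)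
      have i2 : Integrable (fun y => inner ℝ (g y) ν * φ y) (volume.restrict Ω) :=
        (hgL.inner_const (𝕜 := ℝ) ν).integrable_mul_test hφΩ
      rw [← add_eq_zero_iff_eq_neg, ← integral_add i1 i2] at e
      rw [← e]
      refine (setIntegral_eq_integral_of_ae_eq hBΩ ?_ ?_ ?_).symm
      · filter_upwards [hae] with y h1 hy
        rw [Set.indicator_of_mem (h1 hy).1, Set.indicator_of_mem (h1 hy).1, (h1 hy).2,
          real_inner_smul_left, real_inner_comm ν]
      · intro y hy
        simp [hφ.gradient_eq_zero hy, hφ.eq_zero hy]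
      · intro y hy
        simp [hφ.gradient_eq_zero hy, hφ.eq_zero hy]
  · have cD := hP.continuousOn_piecewiseConst Dc
    have cμ := hP.continuousOn_piecewiseConst μc
    have tD := fun k => hP.tendsto_piecewiseConst Dc k x
    have tμ := fun k => hP.tendsto_piecewiseConst μc k x
    refine hI.inner_jump_eq_zero hm hn (h₁ := fun y => piecewiseConst P Dc y • ∇ u y)
      (h₀ := fun y => piecewiseConst P μc y * u y) hr ((cD m).smul cgm) ((cD n).smul cgn)
      ((cμ m).mul hum.continuousOn) ((cμ n).mul hun.continuousOn) ((tD m).smul tb)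
      ((tD n).smul tb') ((tμ m).mul ta) ((tμ n).mul ta') ?_
    intro φ hφ
    rw [← hw φ (hφ.mono hBΩ)]
    refine (setIntegral_eq_integral_of_ae_eq hBΩ ?_ ?_ ?_).symm
    · filter_upwards [hae] with y h1 hy
      rw [Set.indicator_of_mem (h1 hy).1, Set.indicator_of_mem (h1 hy).1, (h1 hy).2,
        real_inner_smul_left]
    · intro y hy
      simp [hφ.gradient_eq_zero hy, hφ.eq_zero hy]
    · intro y hy
      simp [hφ.gradient_eq_zero hy, hφ.eq_zero hy]

/-- Every small ball around `x` meets the open set `P k` in positive measure, so the essential lower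
bound of `u` on a compact ball passes to the limit. -/
theorem IsFluence.pos_of_tendsto {μ D : E3 → ℝ} (hP : IsPartition Ω P)
    (hu : IsFluence Ω P μ D u) {k : Fin M} {x : E3} (hx : x ∈ Ω) (hxk : x ∈ closure (P k)) {a : ℝ}
    (ta : Tendsto u (𝓝[P k] x) (𝓝 a)) : 0 < a := by
  obtain ⟨r, hr, hball⟩ := Metric.nhds_basis_closedBall.mem_iff.1 (hP.isOpen.mem_nhds hx)
  obtain ⟨c, hc, hae⟩ := hu.pos _ (isCompact_closedBall x r) hball
  rw [ae_restrict_iff' measurableSet_closedBall] at hae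
  refine hc.trans_le ?_
  by_contra! hac
  have hev := ta.eventually (eventually_lt_nhds hac)
  rw [eventually_nhdsWithin_iff] at hev
  obtain ⟨s, hs, hsb⟩ := Metric.nhds_basis_ball.eventually_iff.1 hev
  have hmin : 0 < min r s := lt_min hr hs
  have hpos : 0 < volume (Metric.ball x (min r s) ∩ P k) :=
    (Metric.isOpen_ball.inter (hP.isOpen_part k)).measure_pos volume
      (mem_closure_iff.1 hxk _ Metric.isOpen_ball (Metric.mem_ball_self hmin))
  refine hpos.ne' (measure_mono_null ?_ hae)
  intro y hy hy'
  have h1 := hsb (Metric.ball_subset_ball (min_le_right r s) hy.1) hy.2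
  have h2 := hy' (Metric.ball_subset_closedBall
    (Metric.ball_subset_ball (min_le_left r s) hy.1))
  exact absurd h1 (not_lt.2 h2)

/-- Inside `P k` the function `g` is a constant multiple of `u`, so it inherits the weak equation,
and being `C²` it satisfies it classically although `u` is only assumed `C¹`. Continuity of `g`,
`∇g` and `Δg` carries the identities to the boundary point. -/
theorem IsFluence.values_of_contDiffOn (hP : IsPartition Ω P) (hD : ∀ m, 0 < Dc m)
    (hu : IsFluence Ω P (piecewiseConst P μc) (piecewiseConst P Dc) u)
    {B : Set E3} {g : E3 → ℝ} (hB : IsOpen B) (hg : ContDiffOn ℝ 2 g B)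
    (hHg : ∀ᵐ y, y ∈ B → piecewiseConst P Γc y * piecewiseConst P μc y * u y = g y)
    {k : Fin M} {x : E3} (hxB : x ∈ B) (hxk : x ∈ closure (P k)) {a : ℝ} {b : E3}
    (ta : Tendsto u (𝓝[P k] x) (𝓝 a)) (tb : Tendsto (∇ u) (𝓝[P k] x) (𝓝 b)) :
    g x = Γc k * μc k * a ∧ ∇ g x = (Γc k * μc k) • b ∧ lap g x = μc k / Dc k * g x := by
  have hk := hP.isOpen_part k
  have huk := hu.contDiffOn k
  have hne : (𝓝[P k] x).NeBot := mem_closure_iff_nhdsWithin_neBot.1 hxk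
  set γ := Γc k * μc k
  have hV : IsOpen (P k ∩ B) := hk.inter hB
  have heq : ∀ y ∈ P k ∩ B, g y = γ * u y := fun y hy => by
    have := eqOn_of_ae_eq hB hk hg.continuousOn (((hP.continuousOn_piecewiseConst Γc k).mul
      (hP.continuousOn_piecewiseConst μc k)).mul huk.continuousOn) hHg hy
    rw [← this, Pi.mul_apply, Pi.mul_apply, hP.piecewiseConst_eq _ hy.1,
      hP.piecewiseConst_eq _ hy.1]
  have hgrad : ∀ y ∈ P k ∩ B, ∇ g y = γ • ∇ u y := fun y hy => by
    have hev : g =ᶠ[𝓝 y] fun y => γ * u y := by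
      filter_upwards [hV.mem_nhds hy] with z hz using heq z hz
    have hd : DifferentiableAt ℝ u y :=
      (huk.differentiableOn one_ne_zero).differentiableAt (hk.mem_nhds hy.1)
    refine eq_of_inner_stdVec fun i => ?_
    rw [real_inner_smul_left, inner_gradient_left, inner_gradient_left, hev.fderiv_eq,
      fderiv_const_mul hd]
    simp
  have hlap : ∀ y ∈ P k ∩ B, lap g y = μc k / Dc k * g y := by
    refine lap_eq_of_integral_lap hV (hg.mono Set.inter_subset_right) fun φ hφ => ?_
    have hsupp : ∀ ψ : E3 → ℝ, (∀ y ∉ P k ∩ B, ψ y = 0) →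
        ∫ y, g y * ψ y = γ * ∫ y, u y * ψ y := fun ψ hψ => by
      rw [← integral_const_mul]
      refine integral_congr_ae (Eventually.of_forall fun y => ?_)
      by_cases hy : y ∈ P k ∩ B
      · simp only [heq y hy, mul_assoc]
      · simp [hψ y hy]
    have hw := hu.weak.integral_lap (Set.inter_subset_left.trans (hP.subset k))
      (Eventually.of_forall fun y hy => hP.piecewiseConst_eq μc hy.1)
      (Eventually.of_forall fun y hy => hP.piecewiseConst_eq Dc hy.1) hφ
    rw [hsupp _ fun y hy => hφ.lap_eq_zero hy, hsupp _ fun y hy => hφ.eq_zero hy]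
    have := (hD k).ne'
    field_simp
    linear_combination γ * hw
  have hnear : ∀ᶠ y in 𝓝[P k] x, y ∈ P k ∩ B := by
    filter_upwards [self_mem_nhdsWithin, nhdsWithin_le_nhds (hB.mem_nhds hxB)] with y h1 h2
    exact ⟨h1, h2⟩
  have tg : Tendsto g (𝓝[P k] x) (𝓝 (g x)) :=
    (hg.continuousOn.continuousAt (hB.mem_nhds hxB)).tendsto.mono_left nhdsWithin_le_nhds
  have tdg : Tendsto (∇ g) (𝓝[P k] x) (𝓝 (∇ g x)) :=
    ((continuousOn_gradient hB (hg.of_le (by norm_num))).continuousAt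
      (hB.mem_nhds hxB)).tendsto.mono_left nhdsWithin_le_nhds
  have tl : Tendsto (lap g) (𝓝[P k] x) (𝓝 (lap g x)) :=
    ((continuousOn_lap hB hg).continuousAt (hB.mem_nhds hxB)).tendsto.mono_left
      nhdsWithin_le_nhds
  refine ⟨tendsto_nhds_unique (tg.congr' ?_) (ta.const_mul γ),
    tendsto_nhds_unique (tdg.congr' ?_) (tb.const_smul γ),
    tendsto_nhds_unique (tl.congr' ?_) (tg.const_mul _)⟩
  · filter_upwards [hnear] with y hy using heq y hy
  · filter_upwards [hnear] with y hy using hgrad y hy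
  · filter_upwards [hnear] with y hy using hlap y hy

theorem IsPartition.mem_jumpSet_of_ne (hP : IsPartition Ω P) (c : Fin M → ℝ) {m n : Fin M}
    {x : E3} (hx : x ∈ Ω) (hm : x ∈ closure (P m)) (hn : x ∈ closure (P n)) (h : c m ≠ c n) :
    x ∈ jumpSet 0 Ω (piecewiseConst P c) := by
  by_contra hJ
  obtain ⟨B, -, hB, hxB, g, hg, hae⟩ := (notMem_jumpSet_iff hx).1 hJ
  have e : ∀ k, x ∈ closure (P k) → g x = c k := fun k hk =>
    eq_of_tendsto_of_ae_eq hB (hP.isOpen_part k) hxB hk hg.continuousOn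
      (hP.continuousOn_piecewiseConst c k) hae (hP.tendsto_piecewiseConst c k x)
  exact h ((e m hm).symm.trans (e n hn))

theorem IsFluence.coeff_eq_of_contDiffOn (hP : IsPartition Ω P) (hμ : ∀ m, 0 < μc m)
    (hD : ∀ m, 0 < Dc m)
    (hu : IsFluence Ω P (piecewiseConst P μc) (piecewiseConst P Dc) u)
    {B : Set E3} {g : E3 → ℝ} (hB : IsOpen B) (hg : ContDiffOn ℝ 2 g B)
    (hHg : ∀ᵐ y, y ∈ B → piecewiseConst P Γc y * piecewiseConst P μc y * u y = g y)
    (hΓ : ∀ m, 0 < Γc m) {m n : Fin M} {x ν : E3} (hx : x ∈ Ω) (hxB : x ∈ B)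
    (hI : IsInterfaceNormal P m n x ν)
    (hlim : ∀ k, k = m ∨ k = n →
      (∃ a : ℝ, Tendsto u (𝓝[P k] x) (𝓝 a)) ∧ (∃ b : E3, Tendsto (∇ u) (𝓝[P k] x) (𝓝 b)))
    (hnd : x ∈ jumpSet 0 Ω (piecewiseConst P Dc) \
        (jumpSet 0 Ω (fun y => piecewiseConst P Γc y * piecewiseConst P μc y) ∪
          jumpSet 0 Ω (fun y => piecewiseConst P μc y / piecewiseConst P Dc y)) →
      0 < |inner ℝ (innerGradient (P n) u x) ν|) :
    μc m = μc n ∧ Dc m = Dc n ∧ Γc m = Γc n := by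
  obtain ⟨⟨a, ta⟩, b, tb⟩ := hlim m (Or.inl rfl)
  obtain ⟨⟨a', ta'⟩, b', tb'⟩ := hlim n (Or.inr rfl)
  have hxm := hI.mem_closure_left
  have hxn := hI.mem_closure_right
  obtain ⟨rfl, hflux⟩ := hu.interface_conditions hP hx hI ta ta' tb tb'
  have ha := hu.pos_of_tendsto hP hx hxm ta
  obtain ⟨v1, v2, v3⟩ := hu.values_of_contDiffOn hP hD hB hg hHg hxB hxm ta tb
  obtain ⟨v1', v2', v3'⟩ := hu.values_of_contDiffOn hP hD hB hg hHg hxB hxn ta' tb'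
  have hγ : Γc m * μc m = Γc n * μc n := mul_right_cancel₀ ha.ne' (v1.symm.trans v1')
  have hγ0 : 0 < Γc m * μc m := mul_pos (hΓ m) (hμ m)
  have hg0 : g x ≠ 0 := by
    rw [v1]
    exact (mul_pos hγ0 ha).ne'
  have hκ : μc m / Dc m = μc n / Dc n := mul_right_cancel₀ hg0 (v3.symm.trans v3')
  have hb : b = b' := by
    have := v2.symm.trans v2'
    rw [← hγ] at this
    exact smul_right_injective _ hγ0.ne' this
  subst hb
  have hDeq : Dc m = Dc n := by
    -- A jump of `D` with equal gradients makes the flux condition read `(Dc m - Dc n) ∂_ν u = 0`.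
    -- Since `Γμ` and `μ/D` do not jump, `x` is a point where the nondegeneracy hypothesis applies.
    by_contra hne
    rw [← sub_smul, inner_smul_right] at hflux
    have hbν : inner ℝ ν b = 0 := (mul_eq_zero.1 hflux).resolve_left (sub_ne_zero.2 hne)
    obtain ⟨W, hW, hWae⟩ := hI.exists_nhds_ae_mem
    have h1 := hP.mem_jumpSet_of_ne Dc hx hxm hxn hne
    have h2 : x ∉ jumpSet 0 Ω (fun y => piecewiseConst P Γc y * piecewiseConst P μc y) := by
      refine notMem_jumpSet_of_ae_eq_const (a := Γc m * μc m) hP.isOpen hx hW ?_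
      filter_upwards [hWae] with y hy hyW
      rcases hy hyW with h | h
      · rw [hP.piecewiseConst_eq _ h, hP.piecewiseConst_eq _ h]
      · rw [hP.piecewiseConst_eq _ h, hP.piecewiseConst_eq _ h, hγ]
    have h3 : x ∉ jumpSet 0 Ω (fun y => piecewiseConst P μc y / piecewiseConst P Dc y) := by
      refine notMem_jumpSet_of_ae_eq_const (a := μc m / Dc m) hP.isOpen hx hW ?_
      filter_upwards [hWae] with y hy hyW
      rcases hy hyW with h | h
      · rw [hP.piecewiseConst_eq _ h, hP.piecewiseConst_eq _ h]
      · rw [hP.piecewiseConst_eq _ h, hP.piecewiseConst_eq _ h, hκ]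
    have h4 := hnd ⟨h1, fun h => h.elim h2 h3⟩
    rw [innerGradient, extendFrom_eq hxn tb', real_inner_comm, hbν, abs_zero] at h4
    exact lt_irrefl _ h4
  have hμeq : μc m = μc n := by
    rw [hDeq] at hκ
    exact (div_left_inj' (hD n).ne').1 hκ
  refine ⟨hμeq, hDeq, ?_⟩
  rw [hμeq] at hγ
  exact mul_right_cancel₀ (hμ n).ne' hγ

theorem IsFluence.exists_nhds_ae_eq_of_notMem_jumpSet (hP : IsPartition Ω P)
    (hμ : ∀ m, 0 < μc m) (hD : ∀ m, 0 < Dc m) (hΓ : ∀ m, 0 < Γc m)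
    (hu : IsFluence Ω P (piecewiseConst P μc) (piecewiseConst P Dc) u)
    (hnd : NormalDerivNonvanishing Ω P (piecewiseConst P μc) (piecewiseConst P Dc)
      (piecewiseConst P Γc) u) {x : E3} (hx : x ∈ Ω)
    (hJ : x ∉ jumpSet 2 Ω fun y => piecewiseConst P Γc y * piecewiseConst P μc y * u y) :
    ∃ V ∈ 𝓝 x, ∃ c : ℝ × ℝ × ℝ, ∀ᵐ y, y ∈ V →
      (piecewiseConst P μc y, piecewiseConst P Dc y, piecewiseConst P Γc y) = c := by
  obtain ⟨O, hOΩ, hO, hxO, g, hg, hHg⟩ := (notMem_jumpSet_iff hx).1 hJ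
  obtain ⟨r, hr, hball⟩ := Metric.isOpen_iff.1 hO x hxO
  have hlim := hu.extends_ae
  rw [ae_restrict_iff' hP.isOpen.measurableSet] at hlim
  rw [NormalDerivNonvanishing, ae_restrict_iff' ((measurableSet_jumpSet hP.isOpen).diff
    ((measurableSet_jumpSet hP.isOpen).union (measurableSet_jumpSet hP.isOpen)))] at hnd
  -- The exceptional set is the union of three `H²`-null sets: the singular boundary points, the
  -- points without one-sided limits, and those where nondegeneracy fails.
  refine ⟨_, Metric.ball_mem_nhds x hr, exists_ae_eq_const (B := Metric.ball x r)
    Metric.isOpen_ball (convex_ball x r) ⟨x, Metric.mem_ball_self hr⟩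
    (measure_union_null (measure_union_null hP.null_singular hlim) hnd) ?_⟩
  intro y hyB hyE
  simp only [Set.mem_union, not_or, Set.mem_compl_iff, Set.mem_ofPred_eq, not_not] at hyE
  obtain ⟨⟨h1, h2⟩, h3⟩ := hyE
  have hyO := hball hyB
  have hyΩ := hOΩ hyO
  by_cases hin : ∃ k, y ∈ P k
  · obtain ⟨k, hk⟩ := hin
    refine ⟨P k, (hP.isOpen_part k).mem_nhds hk, (μc k, Dc k, Γc k), ?_⟩
    refine Eventually.of_forall fun z hz => ?_
    rw [hP.piecewiseConst_eq _ hz, hP.piecewiseConst_eq _ hz, hP.piecewiseConst_eq _ hz]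
  · obtain ⟨k, hk⟩ := hP.exists_mem_closure hyΩ
    have hfr : y ∈ frontier (P k) := by
      rw [(hP.isOpen_part k).frontier_eq]
      exact ⟨hk, fun h => hin ⟨k, h⟩⟩
    obtain ⟨m, n, ν, hI⟩ : ∃ m n ν, IsInterfaceNormal P m n y ν := by
      by_contra hno
      exact h1 ⟨⟨hyΩ, Set.mem_iUnion.2 ⟨k, hfr⟩⟩, hno⟩
    obtain ⟨e1, e2, e3⟩ := hu.coeff_eq_of_contDiffOn hP hμ hD hO hg hHg hΓ hyΩ hyO hI
      (h2 hyΩ m n ν hI) fun h => h3 h m n ν hI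
    obtain ⟨W, hW, hWae⟩ := hI.exists_nhds_ae_mem
    refine ⟨W, hW, (μc m, Dc m, Γc m), ?_⟩
    filter_upwards [hWae] with z hz hzW
    rcases hz hzW with h | h
    · rw [hP.piecewiseConst_eq _ h, hP.piecewiseConst_eq _ h, hP.piecewiseConst_eq _ h]
    · rw [hP.piecewiseConst_eq _ h, hP.piecewiseConst_eq _ h, hP.piecewiseConst_eq _ h, e1, e2,
        e3]

/-- Every point of `B` lies in the closure of some part, so the continuous representative takes
values in the finite set `Set.range c` everywhere on `B`; connectedness makes it constant. -/
theorem IsPartition.ae_eq_of_continuousOn (hP : IsPartition Ω P) {c : Fin M → ℝ} {B : Set E3}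
    {g : E3 → ℝ} (hB : IsOpen B) (hBc : IsPreconnected B) (hBΩ : B ⊆ Ω) (hg : ContinuousOn g B)
    (hae : ∀ᵐ y, y ∈ B → piecewiseConst P c y = g y) {m : Fin M} (hm : (P m ∩ B).Nonempty) :
    ∀ᵐ y, y ∈ B → piecewiseConst P c y = c m := by
  have hmaps : Set.MapsTo g B (Set.range c) := fun y hy => by
    obtain ⟨k, hk⟩ := hP.exists_mem_closure (hBΩ hy)
    exact ⟨k, (eq_of_tendsto_of_ae_eq hB (hP.isOpen_part k) hy hk hg
      (hP.continuousOn_piecewiseConst c k) hae (hP.tendsto_piecewiseConst c k y)).symm⟩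
  obtain ⟨y₀, hy₀, hy₀B⟩ := hm
  have hgm : g y₀ = c m := by
    rw [← eqOn_of_ae_eq hB (hP.isOpen_part m) hg (hP.continuousOn_piecewiseConst c m) hae
      ⟨hy₀, hy₀B⟩, hP.piecewiseConst_eq c hy₀]
  filter_upwards [hae] with y h1 hy
  rw [h1 hy, ← hgm]
  exact hBc.constant_of_mapsTo (Set.finite_range c).isDiscrete hg hmaps hy hy₀B

theorem IsFluence.notMem_jumpSet_two (hP : IsPartition Ω P) (hμ : ∀ m, 0 < μc m)
    (hD : ∀ m, 0 < Dc m)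
    (hu : IsFluence Ω P (piecewiseConst P μc) (piecewiseConst P Dc) u) {x : E3} (hx : x ∈ Ω)
    (h1 : x ∉ jumpSet 0 Ω (piecewiseConst P μc)) (h2 : x ∉ jumpSet 0 Ω (piecewiseConst P Dc))
    (h3 : x ∉ jumpSet 0 Ω (piecewiseConst P Γc)) :
    x ∉ jumpSet 2 Ω fun y => piecewiseConst P Γc y * piecewiseConst P μc y * u y := by
  obtain ⟨B₁, hB₁Ω, hB₁, hx₁, g₁, hg₁, ha₁⟩ := (notMem_jumpSet_iff hx).1 h1
  obtain ⟨B₂, hB₂Ω, hB₂, hx₂, g₂, hg₂, ha₂⟩ := (notMem_jumpSet_iff hx).1 h2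
  obtain ⟨B₃, hB₃Ω, hB₃, hx₃, g₃, hg₃, ha₃⟩ := (notMem_jumpSet_iff hx).1 h3
  obtain ⟨R, hR, hball⟩ := Metric.mem_nhds_iff.1
    (inter_mem (inter_mem (hB₁.mem_nhds hx₁) (hB₂.mem_nhds hx₂)) (hB₃.mem_nhds hx₃))
  set B := Metric.ball x R with hBdef
  have s₁ : B ⊆ B₁ := fun y hy => (hball hy).1.1
  have s₂ : B ⊆ B₂ := fun y hy => (hball hy).1.2
  have s₃ : B ⊆ B₃ := fun y hy => (hball hy).2
  have hBΩ : B ⊆ Ω := s₁.trans hB₁Ω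
  have hBo : IsOpen B := Metric.isOpen_ball
  have hBc : IsPreconnected B := (convex_ball x R).isPreconnected
  obtain ⟨m, hm⟩ := hP.exists_mem_closure hx
  have hmB : (P m ∩ B).Nonempty := by
    rw [Set.inter_comm]
    exact mem_closure_iff.1 hm B hBo (Metric.mem_ball_self hR)
  have hconst : ∀ (c : Fin M → ℝ) (O : Set E3) (g : E3 → ℝ), B ⊆ O → ContDiffOn ℝ 0 g O →
      (∀ᵐ y, y ∈ O → piecewiseConst P c y = g y) →
      ∀ᵐ y, y ∈ B → piecewiseConst P c y = c m := fun c O g hBO hg ha =>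
    hP.ae_eq_of_continuousOn hBo hBc hBΩ (hg.continuousOn.mono hBO)
      (by filter_upwards [ha] with y hy hyB using hy (hBO hyB)) hmB
  have e₁ := hconst μc B₁ g₁ s₁ hg₁ ha₁
  have e₂ := hconst Dc B₂ g₂ s₂ hg₂ ha₂
  have e₃ := hconst Γc B₃ g₃ s₃ hg₃ ha₃
  -- Weyl's lemma asks for local integrability on the whole space, so `u` is cut off outside the
  -- ball; test functions supported there do not see the change.
  have hloc : LocallyIntegrable (B.indicator u) := by
    refine Integrable.locallyIntegrable ((integrable_indicator_iff hBo.measurableSet).2 ?_)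
    have hL : MemLp u 2 (volume.restrict B) :=
      hu.weak.1.mono_measure (Measure.restrict_mono hBΩ le_rfl)
    have : IsFiniteMeasure (volume.restrict B : Measure E3) :=
      ⟨by simpa using measure_ball_lt_top⟩
    exact MemLp.integrable (q := 2) (by norm_num) hL
  obtain ⟨w, hw, hae⟩ := exists_contDiff_of_integral_lap (x₀ := x) (k := √(μc m / Dc m)) hR
    (Real.sqrt_nonneg _) hloc (by
      intro φ hφ
      have hind : ∀ ψ : E3 → ℝ, (∀ y ∉ B, ψ y = 0) →
          ∫ y, B.indicator u y * ψ y = ∫ y, u y * ψ y := fun ψ hψ => by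
        refine integral_congr_ae (Eventually.of_forall fun y => ?_)
        by_cases hy : y ∈ B
        · simp [hy]
        · simp [hψ y hy]
      have hwk := hu.weak.integral_lap hBΩ e₁ e₂ hφ
      rw [hind _ fun y hy => hφ.lap_eq_zero hy, hind _ fun y hy => hφ.eq_zero hy,
        Real.sq_sqrt (div_nonneg (hμ m).le (hD m).le)]
      have := (hD m).ne'
      field_simp
      linear_combination hwk)
  rw [notMem_jumpSet_iff hx]
  have hsub : Metric.ball x (R / 2) ⊆ B := Metric.ball_subset_ball (by linarith)
  refine ⟨Metric.ball x (R / 2), hsub.trans hBΩ, Metric.isOpen_ball,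
    Metric.mem_ball_self (half_pos hR), fun y => Γc m * μc m * w y,
    (contDiff_const.mul hw).contDiffOn, ?_⟩
  filter_upwards [e₁, e₃, hae] with y h1 h3 h4 hy
  rw [h1 (hsub hy), h3 (hsub hy), ← h4 hy, Set.indicator_of_mem (hsub hy)]

end partition

end Photoacoustic

/-! ### The equality of jump sets -/

theorem proposition1 {M : ℕ} (Ω : Set Photoacoustic.E3) (P : Fin M → Set Photoacoustic.E3)
    (hP : Photoacoustic.IsPartition Ω P)
    (μc Dc Γc : Fin M → ℝ)
    (hμ : ∀ m, 0 < μc m) (hD : ∀ m, 0 < Dc m) (hΓ : ∀ m, 0 < Γc m)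
    (μ D Γ u H : Photoacoustic.E3 → ℝ)
    (hμ_def : μ = Photoacoustic.piecewiseConst P μc)
    (hD_def : D = Photoacoustic.piecewiseConst P Dc)
    (hΓ_def : Γ = Photoacoustic.piecewiseConst P Γc)
    (hu : Photoacoustic.IsFluence Ω P μ D u)
    (hH_def : H = fun x => Γ x * μ x * u x)
    (hnd : Photoacoustic.NormalDerivNonvanishing Ω P μ D Γ u) :
    closure (Photoacoustic.jumpSet 0 Ω μ) ∪ closure (Photoacoustic.jumpSet 0 Ω D) ∪
        closure (Photoacoustic.jumpSet 0 Ω Γ) =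
      closure (Photoacoustic.jumpSet 2 Ω H) := by
  subst hμ_def hD_def hΓ_def hH_def
  -- Closure commutes with finite unions, which reduces the claim to equality of the jump sets
  -- themselves.
  rw [← closure_union, ← closure_union]
  congr 1
  refine Set.Subset.antisymm ?_ ?_
  · intro x hxJ
    have hx : x ∈ Ω := by
      rcases hxJ with (h | h) | h <;> exact h.1
    by_contra hJ
    obtain ⟨V, hV, c, hc⟩ :=
      hu.exists_nhds_ae_eq_of_notMem_jumpSet hP hμ hD hΓ hnd hx hJ
    rcases hxJ with (h | h) | h
    · refine Photoacoustic.notMem_jumpSet_of_ae_eq_const (a := c.1) hP.isOpen hx hV ?_ h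
      filter_upwards [hc] with y hy hyV using congrArg Prod.fst (hy hyV)
    · refine Photoacoustic.notMem_jumpSet_of_ae_eq_const (a := c.2.1) hP.isOpen hx hV ?_ h
      filter_upwards [hc] with y hy hyV using congrArg (fun p => p.2.1) (hy hyV)
    · refine Photoacoustic.notMem_jumpSet_of_ae_eq_const (a := c.2.2) hP.isOpen hx hV ?_ h
      filter_upwards [hc] with y hy hyV using congrArg (fun p => p.2.2) (hy hyV)
  · intro x hxJ
    by_contra h
    simp only [Set.mem_union, not_or] at h
    exact hu.notMem_jumpSet_two hP hμ hD hxJ.1 h.1.1 h.1.2 h.2 hxJ
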